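/- Fix $m\ge 1$. Let $\vec\beta_p\in\mathbb R^m$ ($p\ge 2$) satisfy $\vec\beta_p=0$ for odd $p$ and $\sum_{p\ge2}2^p\vec\beta_p(j)^2<\infty$ for every $j$; let $\vec h\in\mathbb R^m$, and let $Q$ be a positive semidefinite $m\times m$ matrix with entries in $[-1,1]$ and unit diagonal. Write $\langle A,B\rangle=\mathrm{Tr}(AB)$, let $\odot$ and $A^{\circ p}$ denote entrywise products and powers, and put $\xi'(A)=\sum_{p\ge 2}p\,(\vec\beta_p\otimes\vec\beta_p)\odot A^{\circ(p-1)}$. Consider right-continuous nondecreasing functions $x:[0,m]\to[0,1]$ with $x(m)=1$ (an atom $x(0)>0$ at $0$ is allowed) and Lipschitz paths $\Phi$ from $[0,m]$ to the positive semidefinite matrices, nondecreasing in the positive semidefinite order, with $\Phi(0)=0$ and $\Phi(m)=Q$. Put $t_x=\inf\{t:x(t)=1\}$ and $\hat\Phi(t)=\int_t^m x(s)\Phi'(s)\,ds$. If $|Q-\Phi(t_x)|>0$ (where $|\cdot|$ is the determinant), set $$\mathscr C(x,\Phi)=\frac12\Big[\int_0^m x(t)\langle \xi'(\Phi(t))+\vec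 h\vec h^T,\Phi'(t)\rangle dt+\log|Q-\Phi(\hat T)|+\int_0^{\hat T}\langle\hat\Phi(t)^{-1},\Phi'(t)\rangle dt\Big],$$ where $t_x<\hat T<m$ is any number with $|Q-\Phi(\hat T)|>0$ (the value does not depend on $\hat T$). Let $(x,\Phi)$ attain the infimum of $\mathscr C$ over all pairs as above whose path is $1$-Lipschitz (in the entrywise sup norm) with $\mathrm{Tr}\,\Phi(t)=t$ for all $t$; here the path $\Phi$ of the pair $(x,\Phi)$ itself is continuously differentiable on $[0,m]$ with Lipschitz derivative and is only required to satisfy $\mathrm{Tr}\,\Phi(t)=t$ for $t\in\mathrm{supp}\,\mu_P$, where $\mu_P$ is the probability measure on $[0,m]$ with $\mu_P([0,q])=x(q)$. Suppose that $0\in\mathrm{supp}\,\mu_P$ and $$2\langle\vec\beta_2\otimes\vec\beta_2,\Phi'(0)^{\circ2}\rangle\ne\langle\hat\Phi(0)^{-1}\Phi'(0),\hat\Phi(0)^{-1}\Phi'(0)\rangle .$$ Then there is $\hat q\in(0,m]$ with $\mu_P([0,\hat q])=\mu_P(\{0\})$ and $\mathrm{supp}\,\mu_P\cap[0,\hat q)=\{0\}$;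 in particular, $0$ is an isolated point of $\mathrm{supp}\,\mu_P$. -/

import Mathlib

open MeasureTheory Set
open scoped Matrix

noncomputable section

namespace VectorSpin

/-- The pairing `⟨A, B⟩ = Tr (A B)`; on symmetric matrices it is the Frobenius inner product. -/
def pairing {m : ℕ} (A B : Matrix (Fin m) (Fin m) ℝ) : ℝ := (A * B).trace

/-- The standing assumptions on the inverse temperatures `β p j` (`p ≥ 2`, `j` a copy): only even
`p` occur, and `∑ 2 ^ p β_p(j) ^ 2 < ∞` for every copy `j`. -/
structure IsMixture {m : ℕ} (β : ℕ → Fin m → ℝ) : Prop where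
  even : ∀ p, 3 ≤ p → Odd p → β p = 0
  summable : ∀ j, Summable fun p : ℕ => (2 : ℝ) ^ (p + 2) * β (p + 2) j ^ 2

/-- The matrix `ξ'(A) = ∑_{p ≥ 2} p (β_p ⊗ β_p) ⊙ A^{∘(p-1)}`. -/
def xiDeriv {m : ℕ} (β : ℕ → Fin m → ℝ) (A : Matrix (Fin m) (Fin m) ℝ) :
    Matrix (Fin m) (Fin m) ℝ :=
  Matrix.of fun i j => ∑' p : ℕ, ((p : ℝ) + 2) * (β (p + 2) i * β (p + 2) j) * A i j ^ (p + 1)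

/-- The possible self-overlap constraints: positive semidefinite matrices with entries in `[-1,1]`
and unit diagonal. -/
structure IsConstraint {m : ℕ} (Q : Matrix (Fin m) (Fin m) ℝ) : Prop where
  posSemidef : Q.PosSemidef
  mem_Icc : ∀ i j, Q i j ∈ Icc (-1 : ℝ) 1
  diag : ∀ i, Q i i = 1

/-- Functional order parameters: right-continuous nondecreasing `x : [0,m] → [0,1]`, `x m = 1`.
The normalization at the left end is `x (0-) = 0`, so that `x 0 > 0` (an atom at `0`) is allowed.
Only the values of `x` on `[0,m]` matter. -/
structure IsOrderParameter (m : ℕ) (x : ℝ → ℝ) : Prop where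
  monotoneOn : MonotoneOn x (Icc 0 (m : ℝ))
  rightContinuous : ∀ t ∈ Ico 0 (m : ℝ), ContinuousWithinAt x (Ici t) t
  nonneg : ∀ t ∈ Icc 0 (m : ℝ), 0 ≤ x t
  right_end : x m = 1

/-- `μ` is the measure on `[0,m]` with distribution function `x`, i.e. `μ [0,q] = x q`. -/
structure HasDistribution (m : ℕ) (x : ℝ → ℝ) (μ : Measure ℝ) : Prop where
  measure_compl : μ (Icc 0 (m : ℝ))ᶜ = 0
  measure_Icc : ∀ q ∈ Icc 0 (m : ℝ), μ (Icc 0 q) = ENNReal.ofReal (x q)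

/-- `t_x = inf {t ∈ [0,m] : x t = 1}`. -/
def topPoint (m : ℕ) (x : ℝ → ℝ) : ℝ := sInf {t | t ∈ Icc 0 (m : ℝ) ∧ x t = 1}

/-- Monotone paths `[0,m] → 𝕊₊ᵐ` from `0` to `Q`, for the positive semidefinite order. -/
structure IsMonotonePath {m : ℕ} (Q : Matrix (Fin m) (Fin m) ℝ)
    (Φ : ℝ → Matrix (Fin m) (Fin m) ℝ) : Prop where
  posSemidef : ∀ t ∈ Icc 0 (m : ℝ), (Φ t).PosSemidef
  monotone : ∀ s ∈ Icc 0 (m : ℝ), ∀ t ∈ Icc 0 (m : ℝ), s ≤ t → (Φ t - Φ s).PosSemidef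
  left_end : Φ 0 = 0
  right_end : Φ m = Q

/-- The derivative `Φ'(t)` along `[0,m]`, one-sided at the two end points. -/
def pathDeriv {m : ℕ} (Φ : ℝ → Matrix (Fin m) (Fin m) ℝ) (t : ℝ) : Matrix (Fin m) (Fin m) ℝ :=
  Matrix.of fun i j => derivWithin (fun s => Φ s i j) (Icc 0 (m : ℝ)) t

/-- The class `𝓜₀`: 1-Lipschitz monotone paths (for the entrywise sup norm) with `Tr Φ(t) = t`. -/
structure IsTracePath {m : ℕ} (Q : Matrix (Fin m) (Fin m) ℝ)
    (Φ : ℝ → Matrix (Fin m) (Fin m) ℝ) : Prop extends IsMonotonePath Q Φ where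
  lipschitz : ∀ i j, LipschitzOnWith 1 (fun t => Φ t i j) (Icc 0 (m : ℝ))
  trace : ∀ t ∈ Icc 0 (m : ℝ), (Φ t).trace = t

/-- The class `𝓜`: continuously differentiable Lipschitz monotone paths with Lipschitz derivative,
normalized by `Tr Φ(t) = t` on the support of `μ` only. -/
structure IsSmoothPath {m : ℕ} (Q : Matrix (Fin m) (Fin m) ℝ) (μ : Measure ℝ)
    (Φ : ℝ → Matrix (Fin m) (Fin m) ℝ) : Prop extends IsMonotonePath Q Φ where
  differentiable : ∀ i j, DifferentiableOn ℝ (fun t => Φ t i j) (Icc 0 (m : ℝ))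
  lipschitz : ∃ K, ∀ i j, LipschitzOnWith K (fun t => Φ t i j) (Icc 0 (m : ℝ))
  lipschitz_deriv : ∃ K, ∀ i j, LipschitzOnWith K (fun t => pathDeriv Φ t i j) (Icc 0 (m : ℝ))
  trace : ∀ t ∈ μ.support, (Φ t).trace = t

/-- `Φ̂(t) = ∫_t^m x(s) Φ'(s) ds`. -/
def hatPath {m : ℕ} (x : ℝ → ℝ) (Φ : ℝ → Matrix (Fin m) (Fin m) ℝ) (t : ℝ) :
    Matrix (Fin m) (Fin m) ℝ :=
  Matrix.of fun i j => ∫ s in t..(m : ℝ), x s * pathDeriv Φ s i j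

/-- The cut-offs `t_x < T < m` at which `log |Q - Φ(T)|` makes sense. They exist as soon as
`|Q - Φ(t_x)| > 0`, and the functional below takes the same value at all of them. -/
def IsCutoff {m : ℕ} (Q : Matrix (Fin m) (Fin m) ℝ) (x : ℝ → ℝ)
    (Φ : ℝ → Matrix (Fin m) (Fin m) ℝ) (T : ℝ) : Prop :=
  topPoint m x < T ∧ T < m ∧ 0 < (Q - Φ T).det

/-- The Crisanti-Sommers functional, written with the cut-off `T`. -/
def crisantiSommers {m : ℕ} (β : ℕ → Fin m → ℝ) (h : Fin m → ℝ) (T : ℝ) (x : ℝ → ℝ)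
    (Φ : ℝ → Matrix (Fin m) (Fin m) ℝ) : ℝ :=
  (1 / 2) * ((∫ t in (0 : ℝ)..(m : ℝ),
        x t * pairing (xiDeriv β (Φ t) + Matrix.vecMulVec h h) (pathDeriv Φ t))
      + Real.log (Φ m - Φ T).det
      + ∫ t in (0 : ℝ)..T, pairing (hatPath x Φ t)⁻¹ (pathDeriv Φ t))

/-- `(x, Φ)`, with `Φ` in the class `𝓜`, attains the infimum in the Crisanti-Sommers formula: the
infimum of the functional over all order parameters `y` and all paths `Ψ` in `𝓜₀` subject to
`|Q - Ψ(t_y)| > 0`. Here `μ` is the measure with distribution function `x`. -/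
structure IsMinimizer {m : ℕ} (β : ℕ → Fin m → ℝ) (h : Fin m → ℝ)
    (Q : Matrix (Fin m) (Fin m) ℝ) (x : ℝ → ℝ) (μ : Measure ℝ)
    (Φ : ℝ → Matrix (Fin m) (Fin m) ℝ) : Prop where
  orderParameter : IsOrderParameter m x
  distribution : HasDistribution m x μ
  path : IsSmoothPath Q μ Φ
  det_pos : 0 < (Q - Φ (topPoint m x)).det
  le : ∀ (y : ℝ → ℝ) (Ψ : ℝ → Matrix (Fin m) (Fin m) ℝ), IsOrderParameter m y →
    IsTracePath Q Ψ → 0 < (Q - Ψ (topPoint m y)).det →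
    ∀ S T : ℝ, IsCutoff Q x Φ S → IsCutoff Q y Ψ T →
      crisantiSommers β h S x Φ ≤ crisantiSommers β h T y Ψ

end VectorSpin

end

noncomputable section

namespace VectorSpin

open Filter Topology

variable {m : ℕ}

/-! ### Positive semidefinite matrices -/

/-! Suppose that `x t > x 0` for every `t > 0`, so that `μ` charges every interval `(0, t]`. Write
`G(t) = ξ'(Φ(t)) - ∫_0^t Φ̂⁻¹ Φ' Φ̂⁻¹` (this is `gradient`) and `H = h hᵀ`. Two one-sided variations
of the minimizer suffice for a contradiction.

Lowering `x` on `[0, q)` gives `∫_0^q ⟨G + H, Φ'⟩ ≤ 0` for small `q > 0`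
(`IsRegularPair.integral_pairing_gradient_nonpos`). Shrinking the path to `(1 - ε η) Φ` with `η(t) =
max (q - t) 0 ^ 2` gives `∫ η ⟨G + H, Φ⟩ dμ ≥ 0`
(`IsRegularPair.integral_sq_mul_pairing_gradient_nonneg`).

Near the origin `G(t) ≈ t G'(0)` and `Φ(t) ≈ t Φ'(0)`. With `γ = ⟨G'(0), Φ'(0)⟩`, the first
inequality reads `γ q²/2 + o(q²) + ⟨H, Φ(q)⟩ ≤ 0`. As `⟨H, Φ(q)⟩ ≥ 0`, this forces `γ ≤ 0`; it also
bounds the field term by `|γ| q²/2 + o(q²)`. If `γ < 0`, then `⟨G + H, Φ⟩(t) ≤ γ t²/2 + o(t²) < 0`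
for small `t > 0`, which contradicts the second inequality because `μ` charges `(0, q)`. Hence `γ =
0` (`IsRegularPair.pairing_gradientDeriv_eq_zero`), and `γ` is the difference of the two sides of
the excluded equality (`IsRegularPair.pairing_gradientDeriv_zero_eq`).

Minimality is assumed only against paths with `Tr Φ(t) = t`, which the perturbed paths violate. The
functional is invariant under change of parameter (`crisantiSommers_comp_traceInv`), so running a
path along the inverse of its trace makes every differentiable monotone path a competitor, provided
its trace separates the top point from the cut-off (`IsMinimizer.le_of_differentiable`). -/

lemma abs_apply_le_half_add {M : Matrix (Fin m) (Fin m) ℝ} (hM : M.PosSemidef) (i j : Fin m) :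
    |M i j| ≤ (M i i + M j j) / 2 := by
  by_cases hij : i = j
  · subst hij
    rw [abs_of_nonneg hM.diag_nonneg]
    linarith
  have hsymm : M j i = M i j := by simpa using hM.1.apply i j
  have key : ∀ a : ℝ, 0 ≤ M i i + 2 * a * M i j + a * a * M j j := by
    intro a
    have := hM.dotProduct_mulVec_nonneg (Pi.single i 1 + a • Pi.single j 1)
    simp [Matrix.mulVec_add, Matrix.mulVec_smul, hsymm] at this
    linarith
  have h1 := key 1
  have h2 := key (-1)
  rw [abs_le]
  constructor <;> linarith

/-- Applied to increments, this says that no entry of a monotone path moves more than the trace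
does, which is why the trace can serve as parameter. -/
lemma abs_apply_le_trace {M : Matrix (Fin m) (Fin m) ℝ} (hM : M.PosSemidef) (i j : Fin m) :
    |M i j| ≤ M.trace := by
  have hd : ∀ i, M i i ≤ M.trace := fun i =>
    Finset.single_le_sum (f := fun i => M i i) (fun k _ => hM.diag_nonneg) (Finset.mem_univ i)
  have := abs_apply_le_half_add hM i j
  linarith [hd i, hd j]

lemma quad_eq_sum (M : Matrix (Fin m) (Fin m) ℝ) (v : Fin m → ℝ) :
    star v ⬝ᵥ (M *ᵥ v) = ∑ i, ∑ j, v i * v j * M i j := by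
  simp only [dotProduct, Matrix.mulVec, Finset.mul_sum, Pi.star_apply, star_trivial]
  exact Finset.sum_congr rfl fun i _ => Finset.sum_congr rfl fun j _ => by ring

lemma posDef_of_le {M N : Matrix (Fin m) (Fin m) ℝ} (hM : M.PosSemidef) (hdet : 0 < M.det)
    (h : (N - M).PosSemidef) : N.PosDef := by
  have := (hM.posDef_iff_det_ne_zero.2 hdet.ne').add_posSemidef h
  simpa using this

/-! ### Order parameters -/

lemma topPoint_mem {x : ℝ → ℝ} (hx : IsOrderParameter m x) : topPoint m x ∈ Icc 0 (m : ℝ) := by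
  have hmem : (m : ℝ) ∈ {t | t ∈ Icc 0 (m : ℝ) ∧ x t = 1} := ⟨⟨by positivity, le_rfl⟩, hx.right_end⟩
  exact ⟨le_csInf ⟨_, hmem⟩ fun t ht => ht.1.1, csInf_le ⟨0, fun t ht => ht.1.1⟩ hmem⟩

lemma orderParameter_le_one {x : ℝ → ℝ} (hx : IsOrderParameter m x) {t : ℝ}
    (ht : t ∈ Icc 0 (m : ℝ)) : x t ≤ 1 := by
  rw [← hx.right_end]
  exact hx.monotoneOn ht ⟨ht.1.trans ht.2, le_rfl⟩ ht.2

lemma eq_one_of_topPoint_lt {x : ℝ → ℝ} (hx : IsOrderParameter m x) {t : ℝ}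
    (ht : t ∈ Icc 0 (m : ℝ)) (h : topPoint m x < t) : x t = 1 := by
  have hne : ({t | t ∈ Icc 0 (m : ℝ) ∧ x t = 1}).Nonempty :=
    ⟨m, ⟨⟨ht.1.trans ht.2, le_rfl⟩, hx.right_end⟩⟩
  obtain ⟨s, hs, hst⟩ := exists_lt_of_csInf_lt hne h
  exact le_antisymm (orderParameter_le_one hx ht) (hs.2 ▸ hx.monotoneOn hs.1 ht hst.le)

lemma topPoint_le {x : ℝ → ℝ} {t : ℝ} (ht : t ∈ Icc 0 (m : ℝ)) (h : x t = 1) :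
    topPoint m x ≤ t :=
  csInf_le ⟨0, fun _ ht => ht.1.1⟩ ⟨ht, h⟩

/-- Right continuity makes the infimum attained. -/
lemma apply_topPoint {x : ℝ → ℝ} (hx : IsOrderParameter m x) : x (topPoint m x) = 1 := by
  have hmem := topPoint_mem hx
  rcases hmem.2.eq_or_lt with h | h
  · rw [h, hx.right_end]
  have h1 : Tendsto x (𝓝[>] (topPoint m x)) (𝓝 (x (topPoint m x))) :=
    (hx.rightContinuous _ ⟨hmem.1, h⟩).mono Ioi_subset_Ici_self
  have h2 : Tendsto x (𝓝[>] (topPoint m x)) (𝓝 1) := by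
    refine tendsto_const_nhds.congr' ?_
    filter_upwards [Ioo_mem_nhdsGT h] with t ht
    exact (eq_one_of_topPoint_lt hx ⟨hmem.1.trans ht.1.le, ht.2.le⟩ ht.1).symm
  exact tendsto_nhds_unique h1 h2

/-! ### Differentiable monotone paths -/

section Path

variable {Q : Matrix (Fin m) (Fin m) ℝ} {Φ : ℝ → Matrix (Fin m) (Fin m) ℝ}

lemma hasDerivWithinAt_path (hd : ∀ i j, DifferentiableOn ℝ (fun t => Φ t i j) (Icc 0 (m : ℝ)))
    {t : ℝ} (ht : t ∈ Icc 0 (m : ℝ)) (i j : Fin m) :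
    HasDerivWithinAt (fun s => Φ s i j) (pathDeriv Φ t i j) (Icc 0 (m : ℝ)) t :=
  (hd i j t ht).hasDerivWithinAt

lemma hasDerivAt_path (hd : ∀ i j, DifferentiableOn ℝ (fun t => Φ t i j) (Icc 0 (m : ℝ)))
    {t : ℝ} (ht : t ∈ Ioo 0 (m : ℝ)) (i j : Fin m) :
    HasDerivAt (fun s => Φ s i j) (pathDeriv Φ t i j) t :=
  (hasDerivWithinAt_path hd (Ioo_subset_Icc_self ht) i j).hasDerivAt (Icc_mem_nhds ht.1 ht.2)

lemma uniqueDiffOn_timeInterval (hm : 1 ≤ m) : UniqueDiffOn ℝ (Icc 0 (m : ℝ)) :=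
  uniqueDiffOn_Icc (by exact_mod_cast hm)

lemma pathDeriv_eq_of_hasDerivWithinAt (hm : 1 ≤ m) {D : Matrix (Fin m) (Fin m) ℝ} {t : ℝ}
    (ht : t ∈ Icc 0 (m : ℝ))
    (h : ∀ i j, HasDerivWithinAt (fun s => Φ s i j) (D i j) (Icc 0 (m : ℝ)) t) :
    pathDeriv Φ t = D := by
  ext i j
  exact (h i j).derivWithin (uniqueDiffOn_timeInterval hm t ht)

/-- Each quadratic form of the path is a nondecreasing real function. -/
lemma posSemidef_pathDeriv (hm : 1 ≤ m) (hΦ : IsMonotonePath Q Φ)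
    (hd : ∀ i j, DifferentiableOn ℝ (fun t => Φ t i j) (Icc 0 (m : ℝ)))
    {t : ℝ} (ht : t ∈ Icc 0 (m : ℝ)) : (pathDeriv Φ t).PosSemidef := by
  refine .of_dotProduct_mulVec_nonneg ?_ fun v => ?_
  · ext i j
    simp only [Matrix.conjTranspose_apply, star_trivial, pathDeriv, Matrix.of_apply]
    refine derivWithin_congr (fun s hs => ?_) ?_
    · simpa using (hΦ.posSemidef s hs).1.apply i j
    · simpa using (hΦ.posSemidef t ht).1.apply i j
  · have hder : HasDerivWithinAt (fun s => star v ⬝ᵥ (Φ s *ᵥ v))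
        (star v ⬝ᵥ (pathDeriv Φ t *ᵥ v)) (Icc 0 (m : ℝ)) t := by
      simp only [quad_eq_sum]
      exact HasDerivWithinAt.fun_sum fun i _ => HasDerivWithinAt.fun_sum fun j _ =>
        (hasDerivWithinAt_path hd ht i j).const_mul _
    rw [← hder.derivWithin (uniqueDiffOn_timeInterval hm t ht)]
    refine MonotoneOn.derivWithin_nonneg fun a ha b hb hab => ?_
    have := (hΦ.monotone a ha b hb hab).dotProduct_mulVec_nonneg v
    rw [Matrix.sub_mulVec, dotProduct_sub] at this
    linarith

lemma monotoneOn_trace (hΦ : IsMonotonePath Q Φ) :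
    MonotoneOn (fun t => (Φ t).trace) (Icc 0 (m : ℝ)) := fun a ha b hb hab => by
  have := (hΦ.monotone a ha b hb hab).trace_nonneg
  rw [Matrix.trace_sub] at this
  simpa using this

lemma abs_path_sub_le (hΦ : IsMonotonePath Q Φ) {s t : ℝ} (hs : s ∈ Icc 0 (m : ℝ))
    (ht : t ∈ Icc 0 (m : ℝ)) (i j : Fin m) :
    |Φ t i j - Φ s i j| ≤ |(Φ t).trace - (Φ s).trace| := by
  wlog hst : s ≤ t generalizing s t
  · rw [abs_sub_comm, abs_sub_comm (Φ t).trace]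
    exact this ht hs (le_of_not_ge hst)
  have := abs_apply_le_trace (hΦ.monotone s hs t ht hst) i j
  rw [Matrix.trace_sub] at this
  exact this.trans (le_abs_self _)

lemma path_eq_of_trace_eq (hΦ : IsMonotonePath Q Φ) {s t : ℝ} (hs : s ∈ Icc 0 (m : ℝ))
    (ht : t ∈ Icc 0 (m : ℝ)) (h : (Φ s).trace = (Φ t).trace) : Φ s = Φ t := by
  ext i j
  have := abs_path_sub_le hΦ ht hs i j
  rw [h, sub_self, abs_zero] at this
  linarith [abs_nonpos_iff.1 this]

lemma hasDerivAt_trace (hd : ∀ i j, DifferentiableOn ℝ (fun t => Φ t i j) (Icc 0 (m : ℝ)))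
    {t : ℝ} (ht : t ∈ Ioo 0 (m : ℝ)) :
    HasDerivAt (fun s => (Φ s).trace) (pathDeriv Φ t).trace t :=
  HasDerivAt.fun_sum fun i _ => hasDerivAt_path hd ht i i

lemma continuousOn_path (hd : ∀ i j, DifferentiableOn ℝ (fun t => Φ t i j) (Icc 0 (m : ℝ))) :
    ContinuousOn Φ (Icc 0 (m : ℝ)) :=
  continuousOn_pi.2 fun i => continuousOn_pi.2 fun j => (hd i j).continuousOn

lemma continuousOn_trace (hd : ∀ i j, DifferentiableOn ℝ (fun t => Φ t i j) (Icc 0 (m : ℝ))) :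
    ContinuousOn (fun t => (Φ t).trace) (Icc 0 (m : ℝ)) :=
  continuousOn_finsetSum _ fun i _ => (hd i i).continuousOn

end Path

/-! ### Reparametrization by the trace -/

/-- The right-continuous inverse of the trace of a path. -/
def traceInv (Φ : ℝ → Matrix (Fin m) (Fin m) ℝ) (s : ℝ) : ℝ :=
  sSup {t | t ∈ Icc 0 (m : ℝ) ∧ (Φ t).trace ≤ s}

section Reparametrization

variable {Q : Matrix (Fin m) (Fin m) ℝ} {Φ : ℝ → Matrix (Fin m) (Fin m) ℝ}

lemma trace_constraint (hQ : IsConstraint Q) : Q.trace = m := by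
  simp [Matrix.trace, hQ.diag]

lemma trace_mem (hQ : IsConstraint Q) (hΦ : IsMonotonePath Q Φ) {t : ℝ}
    (ht : t ∈ Icc 0 (m : ℝ)) : (Φ t).trace ∈ Icc 0 (m : ℝ) := by
  refine ⟨(hΦ.posSemidef t ht).trace_nonneg, ?_⟩
  have := monotoneOn_trace hΦ ht ⟨ht.1.trans ht.2, le_rfl⟩ ht.2
  simpa [hΦ.right_end, trace_constraint hQ] using this

lemma traceInv_bddAbove (s : ℝ) : BddAbove {t | t ∈ Icc 0 (m : ℝ) ∧ (Φ t).trace ≤ s} :=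
  ⟨m, fun _ ht => ht.1.2⟩

lemma zero_mem_traceInv_set (hΦ : IsMonotonePath Q Φ) {s : ℝ} (hs : s ∈ Icc 0 (m : ℝ)) :
    (0 : ℝ) ∈ {t | t ∈ Icc 0 (m : ℝ) ∧ (Φ t).trace ≤ s} :=
  ⟨⟨le_rfl, hs.1.trans hs.2⟩, by simpa [hΦ.left_end] using hs.1⟩

lemma traceInv_mem (hΦ : IsMonotonePath Q Φ) {s : ℝ} (hs : s ∈ Icc 0 (m : ℝ)) :
    traceInv Φ s ∈ Icc 0 (m : ℝ) :=
  ⟨le_csSup (traceInv_bddAbove s) (zero_mem_traceInv_set hΦ hs),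
    csSup_le ⟨_, zero_mem_traceInv_set hΦ hs⟩ fun _ ht => ht.1.2⟩

lemma trace_traceInv_le (hΦ : IsMonotonePath Q Φ)
    (hd : ∀ i j, DifferentiableOn ℝ (fun t => Φ t i j) (Icc 0 (m : ℝ)))
    {s : ℝ} (hs : s ∈ Icc 0 (m : ℝ)) : (Φ (traceInv Φ s)).trace ≤ s := by
  have hcl : IsClosed {t | t ∈ Icc 0 (m : ℝ) ∧ (Φ t).trace ≤ s} :=
    (continuousOn_trace hd).preimage_isClosed_of_isClosed isClosed_Icc isClosed_Iic
  exact (hcl.csSup_mem ⟨_, zero_mem_traceInv_set hΦ hs⟩ (traceInv_bddAbove s)).2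

/-- A Galois connection between the trace and its inverse, from which the order properties of
`traceInv` follow. Continuity of the trace enters by making its sublevel sets closed, so that the
supremum is attained. -/
lemma le_traceInv_iff (hΦ : IsMonotonePath Q Φ)
    (hd : ∀ i j, DifferentiableOn ℝ (fun t => Φ t i j) (Icc 0 (m : ℝ)))
    {s t : ℝ} (hs : s ∈ Icc 0 (m : ℝ)) (ht : t ∈ Icc 0 (m : ℝ)) :
    t ≤ traceInv Φ s ↔ (Φ t).trace ≤ s :=
  ⟨fun h => (monotoneOn_trace hΦ ht (traceInv_mem hΦ hs) h).trans (trace_traceInv_le hΦ hd hs),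
    fun h => le_csSup (traceInv_bddAbove s) ⟨ht, h⟩⟩

lemma trace_traceInv (hQ : IsConstraint Q) (hΦ : IsMonotonePath Q Φ)
    (hd : ∀ i j, DifferentiableOn ℝ (fun t => Φ t i j) (Icc 0 (m : ℝ)))
    {s : ℝ} (hs : s ∈ Icc 0 (m : ℝ)) : (Φ (traceInv Φ s)).trace = s := by
  refine le_antisymm (trace_traceInv_le hΦ hd hs) ?_
  have hs' : s ∈ Icc (Φ 0).trace (Φ m).trace := by
    simpa [hΦ.left_end, hΦ.right_end, trace_constraint hQ] using hs
  obtain ⟨t, ht, rfl⟩ := intermediate_value_Icc (hs.1.trans hs.2) (continuousOn_trace hd) hs'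
  exact monotoneOn_trace hΦ ht (traceInv_mem hΦ hs) ((le_traceInv_iff hΦ hd hs ht).2 le_rfl)

lemma path_traceInv_trace (hQ : IsConstraint Q) (hΦ : IsMonotonePath Q Φ)
    (hd : ∀ i j, DifferentiableOn ℝ (fun t => Φ t i j) (Icc 0 (m : ℝ)))
    {t : ℝ} (ht : t ∈ Icc 0 (m : ℝ)) : Φ (traceInv Φ (Φ t).trace) = Φ t :=
  path_eq_of_trace_eq hΦ (traceInv_mem hΦ (trace_mem hQ hΦ ht)) ht
    (trace_traceInv hQ hΦ hd (trace_mem hQ hΦ ht))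

lemma monotoneOn_traceInv (hΦ : IsMonotonePath Q Φ)
    (hd : ∀ i j, DifferentiableOn ℝ (fun t => Φ t i j) (Icc 0 (m : ℝ))) :
    MonotoneOn (traceInv Φ) (Icc 0 (m : ℝ)) := fun _ ha _ hb hab =>
  (le_traceInv_iff hΦ hd hb (traceInv_mem hΦ ha)).2 ((trace_traceInv_le hΦ hd ha).trans hab)

lemma traceInv_right_end (hQ : IsConstraint Q) (hΦ : IsMonotonePath Q Φ)
    (hd : ∀ i j, DifferentiableOn ℝ (fun t => Φ t i j) (Icc 0 (m : ℝ))) :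
    traceInv Φ m = m := by
  have hmem : (m : ℝ) ∈ Icc 0 (m : ℝ) := ⟨by positivity, le_rfl⟩
  exact le_antisymm (traceInv_mem hΦ hmem).2 ((le_traceInv_iff hΦ hd hmem hmem).2
    (by rw [hΦ.right_end, trace_constraint hQ]))

lemma isTracePath_comp_traceInv (hQ : IsConstraint Q) (hΦ : IsMonotonePath Q Φ)
    (hd : ∀ i j, DifferentiableOn ℝ (fun t => Φ t i j) (Icc 0 (m : ℝ))) :
    IsTracePath Q fun s => Φ (traceInv Φ s) where
  posSemidef s hs := hΦ.posSemidef _ (traceInv_mem hΦ hs)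
  monotone s hs t ht hst := hΦ.monotone _ (traceInv_mem hΦ hs) _ (traceInv_mem hΦ ht)
    (monotoneOn_traceInv hΦ hd hs ht hst)
  left_end := by
    have h0 : (0 : ℝ) ∈ Icc 0 (m : ℝ) := ⟨le_rfl, by positivity⟩
    rw [← hΦ.left_end]
    refine path_eq_of_trace_eq hΦ (traceInv_mem hΦ h0) h0 ?_
    rw [trace_traceInv hQ hΦ hd h0, hΦ.left_end, Matrix.trace_zero]
  right_end := by rw [traceInv_right_end hQ hΦ hd, hΦ.right_end]
  lipschitz i j := LipschitzOnWith.of_dist_le_mul fun s hs t ht => by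
    have := abs_path_sub_le hΦ (traceInv_mem hΦ ht) (traceInv_mem hΦ hs) i j
    rw [trace_traceInv hQ hΦ hd hs, trace_traceInv hQ hΦ hd ht] at this
    simpa [Real.dist_eq] using this
  trace s hs := trace_traceInv hQ hΦ hd hs

lemma isOrderParameter_comp_traceInv (hQ : IsConstraint Q) (hΦ : IsMonotonePath Q Φ)
    (hd : ∀ i j, DifferentiableOn ℝ (fun t => Φ t i j) (Icc 0 (m : ℝ)))
    {x : ℝ → ℝ} (hx : IsOrderParameter m x) :
    IsOrderParameter m fun s => x (traceInv Φ s) where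
  monotoneOn s hs t ht hst := hx.monotoneOn (traceInv_mem hΦ hs) (traceInv_mem hΦ ht)
    (monotoneOn_traceInv hΦ hd hs ht hst)
  rightContinuous s hs := by
    have hsI : s ∈ Icc 0 (m : ℝ) := ⟨hs.1, hs.2.le⟩
    have hσ := traceInv_mem hΦ hsI
    have hσm : traceInv Φ s < m := by
      refine hσ.2.lt_of_ne fun h => ?_
      have := trace_traceInv hQ hΦ hd hsI
      rw [h, hΦ.right_end, trace_constraint hQ] at this
      exact hs.2.ne' this
    refine (hx.rightContinuous _ ⟨hσ.1, hσm⟩).tendsto.comp ?_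
    have hnear : ∀ᶠ u in 𝓝[≥] s, u ∈ Ico s m := Ico_mem_nhdsGE hs.2
    have hge : ∀ᶠ u in 𝓝[≥] s, traceInv Φ s ≤ traceInv Φ u := by
      filter_upwards [hnear] with u hu
      exact monotoneOn_traceInv hΦ hd hsI ⟨hs.1.trans hu.1, hu.2.le⟩ hu.1
    refine tendsto_nhdsWithin_of_tendsto_nhds_of_eventually_within _ ?_ hge
    refine tendsto_order.2 ⟨fun a ha => hge.mono fun u hu => ha.trans_le hu, fun b hb => ?_⟩
    -- Capping at `m` keeps the test point in `[0,m]`. Its trace exceeds `s`, and by the Galois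
    -- connection every `u` below that trace has `traceInv Φ u < c`.
    set c := min b m
    have hc : c ∈ Icc 0 (m : ℝ) :=
      ⟨le_min (hσ.1.trans hb.le) (hσ.1.trans hσ.2), min_le_right _ _⟩
    have hsc : s < (Φ c).trace := by
      by_contra hcon
      exact absurd ((le_traceInv_iff hΦ hd hsI hc).2 (not_lt.1 hcon)) (not_le.2 (lt_min hb hσm))
    filter_upwards [hnear, Ico_mem_nhdsGE hsc] with u hu hu'
    refine lt_of_lt_of_le ?_ (min_le_left b m)
    by_contra hcon
    exact absurd ((le_traceInv_iff hΦ hd ⟨hs.1.trans hu.1, hu.2.le⟩ hc).1 (not_lt.1 hcon))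
      (not_le.2 hu'.2)
  nonneg s hs := hx.nonneg _ (traceInv_mem hΦ hs)
  right_end := by rw [traceInv_right_end hQ hΦ hd, hx.right_end]

/-- The trace may be flat elsewhere, but a positive derivative at `t` makes `t` the only time with
its trace value; hence `traceInv` genuinely inverts the trace there. -/
lemma trace_lt_of_pos_deriv (hΦ : IsMonotonePath Q Φ)
    (hd : ∀ i j, DifferentiableOn ℝ (fun t => Φ t i j) (Icc 0 (m : ℝ)))
    {t : ℝ} (ht : t ∈ Ioo 0 (m : ℝ)) (hpos : 0 < (pathDeriv Φ t).trace) :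
    (∀ a ∈ Icc 0 (m : ℝ), a < t → (Φ a).trace < (Φ t).trace) ∧
      ∀ b ∈ Icc 0 (m : ℝ), t < b → (Φ t).trace < (Φ b).trace := by
  have hI := Ioo_subset_Icc_self ht
  have hslope := (hasDerivAt_iff_tendsto_slope.1 (hasDerivAt_trace hd ht)).eventually
    (lt_mem_nhds hpos)
  constructor
  · intro a ha hat
    have h1 := hslope.filter_mono (nhdsWithin_mono t fun y (hy : y < t) => ne_of_lt hy)
    obtain ⟨s, hs, hsl⟩ := (Filter.Eventually.and (Ioo_mem_nhdsLT hat) h1).exists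
    have hsI : s ∈ Icc 0 (m : ℝ) := ⟨ha.1.trans hs.1.le, hs.2.le.trans hI.2⟩
    refine (monotoneOn_trace hΦ ha hsI hs.1.le).trans_lt ?_
    rw [slope_def_field] at hsl
    rcases div_pos_iff.1 hsl with hp | hp <;> linarith [hs.2, hp.1, hp.2]
  · intro b hb htb
    have h1 := hslope.filter_mono (nhdsWithin_mono t fun y (hy : t < y) => ne_of_gt hy)
    obtain ⟨s, hs, hsl⟩ := (Filter.Eventually.and (Ioo_mem_nhdsGT htb) h1).exists
    have hsI : s ∈ Icc 0 (m : ℝ) := ⟨hI.1.trans hs.1.le, hs.2.le.trans hb.2⟩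
    refine lt_of_lt_of_le ?_ (monotoneOn_trace hΦ hsI hb hs.2.le)
    rw [slope_def_field] at hsl
    have := (div_pos_iff_of_pos_right (sub_pos.2 hs.1)).1 hsl
    linarith

lemma traceInv_trace_of_pos_deriv (hQ : IsConstraint Q) (hΦ : IsMonotonePath Q Φ)
    (hd : ∀ i j, DifferentiableOn ℝ (fun t => Φ t i j) (Icc 0 (m : ℝ)))
    {t : ℝ} (ht : t ∈ Ioo 0 (m : ℝ)) (hpos : 0 < (pathDeriv Φ t).trace) :
    traceInv Φ (Φ t).trace = t := by
  have hI := Ioo_subset_Icc_self ht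
  have hτ := trace_mem hQ hΦ hI
  refine le_antisymm ?_ ((le_traceInv_iff hΦ hd hτ hI).2 le_rfl)
  by_contra hcon
  have := (trace_lt_of_pos_deriv hΦ hd ht hpos).2 _ (traceInv_mem hΦ hτ) (not_le.1 hcon)
  exact absurd (trace_traceInv_le hΦ hd hτ) (not_le.2 this)

lemma pathDeriv_comp_traceInv (hm : 1 ≤ m) (hQ : IsConstraint Q) (hΦ : IsMonotonePath Q Φ)
    (hd : ∀ i j, DifferentiableOn ℝ (fun t => Φ t i j) (Icc 0 (m : ℝ)))
    {t : ℝ} (ht : t ∈ Ioo 0 (m : ℝ)) (hpos : 0 < (pathDeriv Φ t).trace) :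
    pathDeriv (fun s => Φ (traceInv Φ s)) (Φ t).trace
      = (pathDeriv Φ t).trace⁻¹ • pathDeriv Φ t := by
  have hI := Ioo_subset_Icc_self ht
  have hτ := trace_mem hQ hΦ hI
  have hlt := trace_lt_of_pos_deriv hΦ hd ht hpos
  have hinv := traceInv_trace_of_pos_deriv hQ hΦ hd ht hpos
  have hm0 : (0 : ℝ) ≤ m := by positivity
  have hτ0 : 0 < (Φ t).trace := by
    simpa [hΦ.left_end] using hlt.1 0 ⟨le_rfl, hm0⟩ ht.1
  have hτm : (Φ t).trace < m := by
    simpa [hΦ.right_end, trace_constraint hQ] using hlt.2 m ⟨hm0, le_rfl⟩ ht.2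
  have hcont : ContinuousAt (traceInv Φ) (Φ t).trace := by
    rw [ContinuousAt, hinv]
    refine tendsto_order.2 ⟨fun a ha => ?_, fun b hb => ?_⟩
    · obtain ⟨a', ha', hat⟩ := exists_between (max_lt ha ht.1)
      have ha'I : a' ∈ Icc 0 (m : ℝ) := ⟨(le_max_right _ _).trans ha'.le, hat.le.trans hI.2⟩
      filter_upwards [Ioo_mem_nhds (hlt.1 a' ha'I hat) hτm] with u hu
      refine ((le_max_left a 0).trans_lt ha').trans_le ?_
      exact (le_traceInv_iff hΦ hd ⟨(hΦ.posSemidef _ ha'I).trace_nonneg.trans hu.1.le, hu.2.le⟩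
        ha'I).2 hu.1.le
    · obtain ⟨b', htb, hb'⟩ := exists_between (lt_min hb ht.2)
      have hb'I : b' ∈ Icc 0 (m : ℝ) := ⟨hI.1.trans htb.le, hb'.le.trans (min_le_right _ _)⟩
      filter_upwards [Ioo_mem_nhds hτ0 (hlt.2 b' hb'I htb), Iio_mem_nhds hτm] with u hu hum
      refine lt_of_lt_of_le ?_ (hb'.le.trans (min_le_left b m))
      by_contra hcon
      exact absurd ((le_traceInv_iff hΦ hd ⟨hu.1.le, le_of_lt hum⟩ hb'I).1 (not_lt.1 hcon))
        (not_le.2 hu.2)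
  -- Inverse function rule: `traceInv` is continuous at this value and is a right inverse of the
  -- trace nearby.
  have hσ : HasDerivAt (traceInv Φ) (pathDeriv Φ t).trace⁻¹ (Φ t).trace := by
    refine HasDerivAt.of_local_left_inverse (f := fun s => (Φ s).trace) hcont ?_ hpos.ne' ?_
    · rw [hinv]; exact hasDerivAt_trace hd ht
    · filter_upwards [Ioo_mem_nhds hτ0 hτm] with u hu
      exact trace_traceInv hQ hΦ hd (Ioo_subset_Icc_self hu)
  refine pathDeriv_eq_of_hasDerivWithinAt hm hτ fun i j => ?_
  have h1 : HasDerivAt (fun s => Φ s i j) (pathDeriv Φ t i j) (traceInv Φ (Φ t).trace) := by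
    rw [hinv]; exact hasDerivAt_path hd ht i j
  have h2 := h1.comp _ hσ
  rw [mul_comm] at h2
  exact h2.hasDerivWithinAt

/-- Substitution `s = Tr Φ(t)`. The trace is only nondecreasing, so the version without injectivity
is used; at flat points the vanishing factor in `hk` makes the value of `g` irrelevant. -/
lemma integral_comp_trace (hm : 1 ≤ m) (hΦ : IsMonotonePath Q Φ)
    (hd : ∀ i j, DifferentiableOn ℝ (fun t => Φ t i j) (Icc 0 (m : ℝ)))
    {g k : ℝ → ℝ} (hk : ∀ t ∈ Ioo 0 (m : ℝ), (pathDeriv Φ t).trace * g (Φ t).trace = k t)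
    {a b : ℝ} (ha : 0 ≤ a) (hab : a ≤ b) (hb : b ≤ m) :
    ∫ s in (Φ a).trace..(Φ b).trace, g s = ∫ t in a..b, k t := by
  have haI : a ∈ Icc 0 (m : ℝ) := ⟨ha, hab.trans hb⟩
  have hbI : b ∈ Icc 0 (m : ℝ) := ⟨ha.trans hab, hb⟩
  have hsub : Ioo a b ⊆ Ioo 0 (m : ℝ) := Ioo_subset_Ioo ha hb
  have h := integral_Icc_deriv_smul_of_deriv_nonneg (f := fun t => (Φ t).trace)
    (f' := fun t => (pathDeriv Φ t).trace) (g := g)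
    ((continuousOn_trace hd).mono (Icc_subset_Icc ha hb))
    (fun t ht => hasDerivAt_trace hd (hsub ht))
    (fun t ht => (posSemidef_pathDeriv hm hΦ hd (Ioo_subset_Icc_self (hsub ht))).trace_nonneg) hab
  rw [intervalIntegral.integral_of_le (monotoneOn_trace hΦ haI hbI hab),
    intervalIntegral.integral_of_le hab, ← integral_Icc_eq_integral_Ioc, ← h,
    integral_Icc_eq_integral_Ioo, integral_Ioc_eq_integral_Ioo]
  exact setIntegral_congr_fun measurableSet_Ioo fun t ht => hk t (hsub ht)

lemma pathDeriv_eq_zero_of_trace (hm : 1 ≤ m) (hΦ : IsMonotonePath Q Φ)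
    (hd : ∀ i j, DifferentiableOn ℝ (fun t => Φ t i j) (Icc 0 (m : ℝ)))
    {t : ℝ} (ht : t ∈ Icc 0 (m : ℝ)) (h : (pathDeriv Φ t).trace = 0) : pathDeriv Φ t = 0 := by
  ext i j
  have := abs_apply_le_trace (posSemidef_pathDeriv hm hΦ hd ht) i j
  rw [h] at this
  simpa using abs_nonpos_iff.1 this

/-- Where `Tr Φ' = 0`, positivity forces `Φ' = 0` and both sides vanish. Elsewhere the factor
cancels the reciprocal produced by the chain rule. -/
lemma trace_mul_pairing_comp (hm : 1 ≤ m) (hQ : IsConstraint Q) (hΦ : IsMonotonePath Q Φ)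
    (hd : ∀ i j, DifferentiableOn ℝ (fun t => Φ t i j) (Icc 0 (m : ℝ)))
    {G K : ℝ → Matrix (Fin m) (Fin m) ℝ} {x : ℝ → ℝ} {t : ℝ} (ht : t ∈ Ioo 0 (m : ℝ))
    (hG : G (Φ t).trace = K t) :
    (pathDeriv Φ t).trace * (x (traceInv Φ (Φ t).trace) * pairing (G (Φ t).trace)
      (pathDeriv (fun s => Φ (traceInv Φ s)) (Φ t).trace))
      = x t * pairing (K t) (pathDeriv Φ t) := by
  have hI := Ioo_subset_Icc_self ht
  rcases (posSemidef_pathDeriv hm hΦ hd hI).trace_nonneg.eq_or_lt with h | h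
  · rw [← h, pathDeriv_eq_zero_of_trace hm hΦ hd hI h.symm]
    simp [pairing]
  · rw [pathDeriv_comp_traceInv hm hQ hΦ hd ht h, traceInv_trace_of_pos_deriv hQ hΦ hd ht h, hG]
    simp only [pairing, Matrix.mul_smul, Matrix.trace_smul, smul_eq_mul]
    field_simp

lemma trace_mul_apply_comp (hm : 1 ≤ m) (hQ : IsConstraint Q) (hΦ : IsMonotonePath Q Φ)
    (hd : ∀ i j, DifferentiableOn ℝ (fun t => Φ t i j) (Icc 0 (m : ℝ)))
    {x : ℝ → ℝ} {t : ℝ} (ht : t ∈ Ioo 0 (m : ℝ)) (i j : Fin m) :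
    (pathDeriv Φ t).trace * (x (traceInv Φ (Φ t).trace) *
      pathDeriv (fun s => Φ (traceInv Φ s)) (Φ t).trace i j)
      = x t * pathDeriv Φ t i j := by
  have hI := Ioo_subset_Icc_self ht
  rcases (posSemidef_pathDeriv hm hΦ hd hI).trace_nonneg.eq_or_lt with h | h
  · rw [← h, pathDeriv_eq_zero_of_trace hm hΦ hd hI h.symm]
    simp
  · rw [pathDeriv_comp_traceInv hm hQ hΦ hd ht h, traceInv_trace_of_pos_deriv hQ hΦ hd ht h]
    simp only [Matrix.smul_apply, smul_eq_mul]
    field_simp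

lemma hatPath_comp_traceInv (hm : 1 ≤ m) (hQ : IsConstraint Q) (hΦ : IsMonotonePath Q Φ)
    (hd : ∀ i j, DifferentiableOn ℝ (fun t => Φ t i j) (Icc 0 (m : ℝ)))
    (x : ℝ → ℝ) {t : ℝ} (ht : t ∈ Icc 0 (m : ℝ)) :
    hatPath (fun s => x (traceInv Φ s)) (fun s => Φ (traceInv Φ s)) (Φ t).trace
      = hatPath x Φ t := by
  ext i j
  have h := integral_comp_trace hm hΦ hd
    (g := fun s => x (traceInv Φ s) * pathDeriv (fun s => Φ (traceInv Φ s)) s i j)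
    (k := fun t => x t * pathDeriv Φ t i j) (fun u hu =>
    trace_mul_apply_comp hm hQ hΦ hd (x := x) hu i j) ht.1 ht.2 le_rfl
  rw [hΦ.right_end, trace_constraint hQ] at h
  exact h

/-- Each integrand is linear in `Φ'`, so the substitution `s = Tr Φ(t)` leaves the integrals
unchanged. The matrices `Φ̂` are themselves such integrals and are carried along, and the logarithm
sees only values of the path. -/
lemma crisantiSommers_comp_traceInv (hm : 1 ≤ m) (hQ : IsConstraint Q) (hΦ : IsMonotonePath Q Φ)
    (hd : ∀ i j, DifferentiableOn ℝ (fun t => Φ t i j) (Icc 0 (m : ℝ)))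
    (β : ℕ → Fin m → ℝ) (h : Fin m → ℝ) (x : ℝ → ℝ) {T : ℝ} (hT : T ∈ Icc 0 (m : ℝ)) :
    crisantiSommers β h (Φ T).trace (fun s => x (traceInv Φ s)) (fun s => Φ (traceInv Φ s))
      = crisantiSommers β h T x Φ := by
  have h0 : (Φ 0).trace = 0 := by rw [hΦ.left_end, Matrix.trace_zero]
  have hmtr : (Φ m).trace = m := by rw [hΦ.right_end, trace_constraint hQ]
  have h1 := integral_comp_trace hm hΦ hd
    (g := fun s => x (traceInv Φ s) * pairing (xiDeriv β (Φ (traceInv Φ s)) + Matrix.vecMulVec h h)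
      (pathDeriv (fun s => Φ (traceInv Φ s)) s))
    (k := fun t => x t * pairing (xiDeriv β (Φ t) + Matrix.vecMulVec h h) (pathDeriv Φ t))
    (fun u hu =>
    trace_mul_pairing_comp hm hQ hΦ hd (x := x)
      (G := fun s => xiDeriv β (Φ (traceInv Φ s)) + Matrix.vecMulVec h h)
      (K := fun t => xiDeriv β (Φ t) + Matrix.vecMulVec h h) hu
      (by simp only [path_traceInv_trace hQ hΦ hd (Ioo_subset_Icc_self hu)]))
    le_rfl (hT.1.trans hT.2) le_rfl
  have h2 := integral_comp_trace hm hΦ hd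
    (g := fun s => 1 * pairing
      (hatPath (fun s => x (traceInv Φ s)) (fun s => Φ (traceInv Φ s)) s)⁻¹
      (pathDeriv (fun s => Φ (traceInv Φ s)) s))
    (k := fun t => 1 * pairing (hatPath x Φ t)⁻¹ (pathDeriv Φ t)) (fun u hu =>
    trace_mul_pairing_comp hm hQ hΦ hd (x := fun _ => 1)
      (G := fun s => (hatPath (fun s => x (traceInv Φ s)) (fun s => Φ (traceInv Φ s)) s)⁻¹)
      (K := fun t => (hatPath x Φ t)⁻¹) hu
      (by simp only [hatPath_comp_traceInv hm hQ hΦ hd x (Ioo_subset_Icc_self hu)]))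
    le_rfl hT.1 hT.2
  rw [h0, hmtr] at h1
  rw [h0] at h2
  simp only [one_mul] at h2
  simp only [crisantiSommers, h1, h2, traceInv_right_end hQ hΦ hd,
    path_traceInv_trace hQ hΦ hd hT]

/-- A minimizer is compared with every pair whose path is merely differentiable. -/
theorem IsMinimizer.le_of_differentiable (hm : 1 ≤ m) (hQ : IsConstraint Q)
    {β : ℕ → Fin m → ℝ} {h : Fin m → ℝ} {x₀ : ℝ → ℝ} {μ : Measure ℝ}
    {Φ₀ : ℝ → Matrix (Fin m) (Fin m) ℝ} (hmin : IsMinimizer β h Q x₀ μ Φ₀)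
    {x : ℝ → ℝ} (hx : IsOrderParameter m x) (hΦ : IsMonotonePath Q Φ)
    (hd : ∀ i j, DifferentiableOn ℝ (fun t => Φ t i j) (Icc 0 (m : ℝ)))
    {S T : ℝ} (hS : IsCutoff Q x₀ Φ₀ S) (hT : IsCutoff Q x Φ T)
    (htr : (Φ (topPoint m x)).trace < (Φ T).trace) :
    crisantiSommers β h S x₀ Φ₀ ≤ crisantiSommers β h T x Φ := by
  have htop := topPoint_mem hx
  have hTI : T ∈ Icc 0 (m : ℝ) := ⟨htop.1.trans hT.1.le, hT.2.1.le⟩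
  have hmI : (m : ℝ) ∈ Icc 0 (m : ℝ) := ⟨by positivity, le_rfl⟩
  have htp := isTracePath_comp_traceInv hQ hΦ hd
  have hop := isOrderParameter_comp_traceInv hQ hΦ hd hx
  have hQT : (Q - Φ T).PosSemidef := hΦ.right_end ▸ hΦ.monotone T hTI m hmI hTI.2
  -- The reparametrized order parameter already equals `1` at the trace of the old top point.
  have hle : topPoint m (fun s => x (traceInv Φ s)) ≤ (Φ (topPoint m x)).trace := by
    refine topPoint_le (trace_mem hQ hΦ htop) ?_
    have hmem := traceInv_mem hΦ (trace_mem hQ hΦ htop)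
    refine le_antisymm (orderParameter_le_one hx hmem) ?_
    rw [← apply_topPoint hx]
    exact hx.monotoneOn htop hmem ((le_traceInv_iff hΦ hd (trace_mem hQ hΦ htop) htop).2 le_rfl)
  have hcut : IsCutoff Q (fun s => x (traceInv Φ s)) (fun s => Φ (traceInv Φ s)) (Φ T).trace := by
    refine ⟨hle.trans_lt htr, ?_, ?_⟩
    · refine (trace_mem hQ hΦ hTI).2.lt_of_ne fun heq => ?_
      have : Φ T = Q := by
        rw [← hΦ.right_end]
        exact path_eq_of_trace_eq hΦ hTI hmI (by rw [heq, hΦ.right_end, trace_constraint hQ])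
      have hpos := hT.2.2
      have : Nonempty (Fin m) := ⟨⟨0, hm⟩⟩
      rw [‹Φ T = Q›, sub_self, Matrix.det_zero] at hpos
      exact lt_irrefl _ hpos
    · simp only [path_traceInv_trace hQ hΦ hd hTI]
      exact hT.2.2
  -- The new top point corresponds to a time before `T`, so `Q - Φ` there dominates the positive
  -- definite `Q - Φ T`.
  have hdet : 0 < (Q - Φ (traceInv Φ (topPoint m fun s => x (traceInv Φ s)))).det := by
    have htop' := topPoint_mem hop
    refine (posDef_of_le hQT hT.2.2 ?_).det_pos
    rw [sub_sub_sub_cancel_left]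
    refine hΦ.monotone _ (traceInv_mem hΦ htop') _ hTI ?_
    by_contra hcon
    have := (le_traceInv_iff hΦ hd htop' hTI).1 (not_le.1 hcon).le
    exact absurd (this.trans hle) (not_le.2 htr)
  rw [← crisantiSommers_comp_traceInv hm hQ hΦ hd β h x hTI]
  exact hmin.le _ _ hop htp hdet _ _ hS hcut

end Reparametrization

/-! ### Entrywise derivatives of matrix-valued functions -/

/-- `U` has entrywise derivative `U'` at `t` within `s`. -/
def HasEntryDerivWithinAt (U : ℝ → Matrix (Fin m) (Fin m) ℝ) (U' : Matrix (Fin m) (Fin m) ℝ)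
    (s : Set ℝ) (t : ℝ) : Prop :=
  ∀ i j, HasDerivWithinAt (fun r => U r i j) (U' i j) s t

lemma pairing_eq_sum (A B : Matrix (Fin m) (Fin m) ℝ) :
    pairing A B = ∑ i, ∑ j, A i j * B j i := by
  simp [pairing, Matrix.trace, Matrix.mul_apply]

lemma pairing_add_left (A B C : Matrix (Fin m) (Fin m) ℝ) :
    pairing (A + B) C = pairing A C + pairing B C := by
  simp [pairing, add_mul]

lemma pairing_sub_left (A B C : Matrix (Fin m) (Fin m) ℝ) :
    pairing (A - B) C = pairing A C - pairing B C := by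
  simp [pairing, sub_mul]

lemma pairing_smul_right (c : ℝ) (A B : Matrix (Fin m) (Fin m) ℝ) :
    pairing A (c • B) = c * pairing A B := by
  simp [pairing]

section EntryDeriv

variable {U W : ℝ → Matrix (Fin m) (Fin m) ℝ} {U' W' : Matrix (Fin m) (Fin m) ℝ} {s : Set ℝ} {t : ℝ}

lemma HasEntryDerivWithinAt.mono {s' : Set ℝ} (hU : HasEntryDerivWithinAt U U' s t) (h : s' ⊆ s) :
    HasEntryDerivWithinAt U U' s' t :=
  fun i j => (hU i j).mono h

lemma HasEntryDerivWithinAt.sub (hU : HasEntryDerivWithinAt U U' s t)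
    (hW : HasEntryDerivWithinAt W W' s t) :
    HasEntryDerivWithinAt (fun r => U r - W r) (U' - W') s t :=
  fun i j => (hU i j).sub (hW i j)

lemma HasEntryDerivWithinAt.pairing (hU : HasEntryDerivWithinAt U U' s t)
    (hW : HasEntryDerivWithinAt W W' s t) :
    HasDerivWithinAt (fun r => pairing (U r) (W r))
      (pairing U' (W t) + pairing (U t) W') s t := by
  simp only [pairing_eq_sum, ← Finset.sum_add_distrib]
  exact HasDerivWithinAt.fun_sum fun i _ => HasDerivWithinAt.fun_sum fun j _ =>
    (hU i j).mul (hW j i)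

lemma HasEntryDerivWithinAt.continuousWithinAt (hU : HasEntryDerivWithinAt U U' s t) :
    ContinuousWithinAt U s t :=
  continuousWithinAt_pi.2 fun i => continuousWithinAt_pi.2 fun j => (hU i j).continuousWithinAt

lemma continuousAt_inv_of_det_ne_zero {A : Matrix (Fin m) (Fin m) ℝ} (h : A.det ≠ 0) :
    ContinuousAt (fun B : Matrix (Fin m) (Fin m) ℝ => B⁻¹) A :=
  continuousAt_matrix_inv A (by simpa using! continuousAt_inv₀ h)

/-- Read off from the resolvent identity `A⁻¹ (A - B) B⁻¹ = B⁻¹ - A⁻¹` and continuity of inversion.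
It is stated within a set because `Φ̂` is differentiated only from the right. -/
lemma HasEntryDerivWithinAt.inv (hU : HasEntryDerivWithinAt U U' s t) (hdet : (U t).det ≠ 0) :
    HasEntryDerivWithinAt (fun r => (U r)⁻¹) (-((U t)⁻¹ * U' * (U t)⁻¹)) s t := by
  have hcont : Tendsto U (𝓝[s \ {t}] t) (𝓝 (U t)) :=
    hU.continuousWithinAt.mono_left (nhdsWithin_mono _ sdiff_subset)
  have hinv : Tendsto (fun r => (U r)⁻¹) (𝓝[s \ {t}] t) (𝓝 (U t)⁻¹) :=
    (continuousAt_inv_of_det_ne_zero hdet).tendsto.comp hcont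
  have hne : ∀ᶠ r in 𝓝[s \ {t}] t, (U r).det ≠ 0 :=
    ((continuous_id.matrix_det.tendsto (U t)).comp hcont).eventually_ne hdet
  have hslope : Tendsto (fun r => (r - t)⁻¹ • (U r - U t)) (𝓝[s \ {t}] t) (𝓝 U') := by
    refine tendsto_pi_nhds.2 fun i => tendsto_pi_nhds.2 fun j => ?_
    simpa [slope_def_field, div_eq_inv_mul] using! (hasDerivWithinAt_iff_tendsto_slope.1 (hU i j))
  have hlim := (hinv.mul hslope).mul_const (U t)⁻¹
  intro i j
  rw [hasDerivWithinAt_iff_tendsto_slope]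
  have hij := (tendsto_pi_nhds.1 (tendsto_pi_nhds.1 hlim.neg i) j)
  refine hij.congr' ?_
  filter_upwards [hne] with r hr
  have e : (U r)⁻¹ * ((r - t)⁻¹ • (U r - U t)) * (U t)⁻¹
      = (r - t)⁻¹ • ((U t)⁻¹ - (U r)⁻¹) := by
    rw [Matrix.mul_smul, Matrix.smul_mul, Matrix.mul_sub, Matrix.sub_mul,
      Matrix.nonsing_inv_mul _ (isUnit_iff_ne_zero.2 hr), Matrix.one_mul, Matrix.mul_assoc,
      Matrix.mul_nonsing_inv _ (isUnit_iff_ne_zero.2 hdet), Matrix.mul_one]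
  simp only [e, slope_def_field, Matrix.neg_apply, Matrix.smul_apply, Matrix.sub_apply,
    smul_eq_mul, div_eq_inv_mul]
  ring

end EntryDeriv

/-! ### The entries of `ξ'` -/

/-- The power series giving the entries of `ξ'`. -/
def xiEntry (β : ℕ → Fin m → ℝ) (i j : Fin m) (a : ℝ) : ℝ :=
  ∑' p : ℕ, ((p : ℝ) + 2) * (β (p + 2) i * β (p + 2) j) * a ^ (p + 1)

/-- The Taylor coefficients of `xiEntry`. -/
def xiCoeff (β : ℕ → Fin m → ℝ) (i j : Fin m) : ℕ → ℝ
  | 0 => 0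
  | p + 1 => ((p : ℝ) + 2) * (β (p + 2) i * β (p + 2) j)

/-- Summability gives decay `2 ^ (-n)` up to a linear factor, which is absorbed by replacing `2`
with `3/2`. A radius larger than `1` is essential: entries of the path reach `±1`, and perturbations
leave `[-1,1]`. -/
lemma abs_xiCoeff_mul_le {β : ℕ → Fin m → ℝ} (hβ : IsMixture β) (i j : Fin m) :
    ∃ C, ∀ n, ‖xiCoeff β i j n‖ * (3 / 2 : ℝ) ^ n ≤ C := by
  set Ci := ∑' p : ℕ, (2 : ℝ) ^ (p + 2) * β (p + 2) i ^ 2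
  set Cj := ∑' p : ℕ, (2 : ℝ) ^ (p + 2) * β (p + 2) j ^ 2
  have hi : ∀ p, (2 : ℝ) ^ (p + 2) * β (p + 2) i ^ 2 ≤ Ci := fun p =>
    (hβ.summable i).le_tsum p fun _ _ => by positivity
  have hj : ∀ p, (2 : ℝ) ^ (p + 2) * β (p + 2) j ^ 2 ≤ Cj := fun p =>
    (hβ.summable j).le_tsum p fun _ _ => by positivity
  have hCi : 0 ≤ Ci := tsum_nonneg fun _ => by positivity
  have hCj : 0 ≤ Cj := tsum_nonneg fun _ => by positivity
  refine ⟨3 * (Ci + Cj), fun n => ?_⟩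
  cases n with
  | zero => simp [xiCoeff]; positivity
  | succ p =>
    have hb : |β (p + 2) i * β (p + 2) j| * 2 ^ (p + 1) ≤ Ci + Cj := by
      have h1 : |β (p + 2) i * β (p + 2) j| ≤ (β (p + 2) i ^ 2 + β (p + 2) j ^ 2) / 2 := by
        rw [abs_le]
        constructor <;> nlinarith [sq_nonneg (β (p + 2) i + β (p + 2) j),
          sq_nonneg (β (p + 2) i - β (p + 2) j)]
      have h2 := hi p
      have h3 := hj p
      have h4 : (0 : ℝ) < 2 ^ (p + 1) := by positivity
      rw [pow_succ _ (p + 1)] at h2 h3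
      nlinarith [mul_le_mul_of_nonneg_right h1 h4.le]
    -- Bernoulli: `(4/3) ^ (p+1) ≥ 1 + (p+1)/3 ≥ (p+2)/3`.
    have hB : ((p : ℝ) + 2) * (3 / 4 : ℝ) ^ (p + 1) ≤ 3 := by
      have := one_add_mul_le_pow (a := (1 / 3 : ℝ)) (by norm_num) (p + 1)
      push_cast at this
      have h2 : ((3 / 4 : ℝ) ^ (p + 1)) * (1 + 1 / 3) ^ (p + 1) = 1 := by
        rw [← mul_pow]; norm_num
      have h3 : (0 : ℝ) < (3 / 4 : ℝ) ^ (p + 1) := by positivity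
      nlinarith
    have e : (3 / 2 : ℝ) ^ (p + 1) = (3 / 4) ^ (p + 1) * 2 ^ (p + 1) := by
      rw [← mul_pow]; norm_num
    rw [xiCoeff, norm_mul, Real.norm_eq_abs, Real.norm_eq_abs, e,
      abs_of_nonneg (by positivity : (0 : ℝ) ≤ p + 2)]
    calc _ = (((p : ℝ) + 2) * (3 / 4 : ℝ) ^ (p + 1))
          * (|β (p + 2) i * β (p + 2) j| * 2 ^ (p + 1)) := by ring
      _ ≤ 3 * (Ci + Cj) := by gcongr

lemma xiEntry_eq_tsum (β : ℕ → Fin m → ℝ) (i j : Fin m) (a : ℝ) :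
    xiEntry β i j a = ∑' n, xiCoeff β i j n * a ^ n := by
  by_cases hs : Summable fun n => xiCoeff β i j n * a ^ n
  · rw [hs.tsum_eq_zero_add]
    simp [xiEntry, xiCoeff]
  · have : ¬ Summable fun p : ℕ => ((p : ℝ) + 2) * (β (p + 2) i * β (p + 2) j) * a ^ (p + 1) :=
      fun h => hs ((summable_nat_add_iff 1).1 h)
    rw [tsum_eq_zero_of_not_summable hs, xiEntry, tsum_eq_zero_of_not_summable this]

lemma hasFPowerSeriesOnBall_xiEntry {β : ℕ → Fin m → ℝ} (hβ : IsMixture β) (i j : Fin m) :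
    HasFPowerSeriesOnBall (xiEntry β i j)
      (FormalMultilinearSeries.ofScalars ℝ (xiCoeff β i j)) 0 (3 / 2 : NNReal) := by
  set p := FormalMultilinearSeries.ofScalars ℝ (xiCoeff β i j)
  obtain ⟨C, hC⟩ := abs_xiCoeff_mul_le hβ i j
  have hr : ((3 / 2 : NNReal) : ENNReal) ≤ p.radius := by
    refine p.le_radius_of_bound C fun n => ?_
    rw [FormalMultilinearSeries.ofScalars_norm]
    simpa using hC n
  have h0 : (0 : ENNReal) < (3 / 2 : NNReal) := by
    rw [ENNReal.coe_pos]; positivity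
  have h := (p.hasFPowerSeriesOnBall (h0.trans_le hr)).mono h0 hr
  refine h.congr fun a _ => ?_
  rw [xiEntry_eq_tsum]
  simpa using! FormalMultilinearSeries.ofScalars_sum_eq (xiCoeff β i j) a

lemma analyticOnNhd_xiEntry {β : ℕ → Fin m → ℝ} (hβ : IsMixture β) (i j : Fin m) :
    AnalyticOnNhd ℝ (xiEntry β i j) (Ioo (-(3 / 2)) (3 / 2)) := by
  intro a ha
  refine (hasFPowerSeriesOnBall_xiEntry hβ i j).analyticOnNhd a ?_
  have : a ∈ Metric.ball (0 : ℝ) ((3 / 2 : NNReal) : ℝ) := by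
    rw [Metric.mem_ball, Real.dist_eq, sub_zero, abs_lt]
    simpa using ha
  rwa [← Metric.eball_coe] at this

lemma hasDerivAt_xiEntry {β : ℕ → Fin m → ℝ} (hβ : IsMixture β) (i j : Fin m) {a : ℝ}
    (ha : a ∈ Ioo (-(3 / 2) : ℝ) (3 / 2)) :
    HasDerivAt (xiEntry β i j) (deriv (xiEntry β i j) a) a :=
  (analyticOnNhd_xiEntry hβ i j a ha).differentiableAt.hasDerivAt

lemma continuousOn_xiEntry {β : ℕ → Fin m → ℝ} (hβ : IsMixture β) (i j : Fin m) :
    ContinuousOn (xiEntry β i j) (Ioo (-(3 / 2)) (3 / 2)) :=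
  (analyticOnNhd_xiEntry hβ i j).continuousOn

lemma continuousOn_deriv_xiEntry {β : ℕ → Fin m → ℝ} (hβ : IsMixture β) (i j : Fin m) :
    ContinuousOn (deriv (xiEntry β i j)) (Ioo (-(3 / 2)) (3 / 2)) :=
  (analyticOnNhd_xiEntry hβ i j).deriv.continuousOn

lemma xiEntry_zero (β : ℕ → Fin m → ℝ) (i j : Fin m) : xiEntry β i j 0 = 0 := by
  simp [xiEntry]

lemma deriv_xiEntry_zero {β : ℕ → Fin m → ℝ} (hβ : IsMixture β) (i j : Fin m) :
    deriv (xiEntry β i j) 0 = 2 * (β 2 i * β 2 j) := by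
  rw [(hasFPowerSeriesOnBall_xiEntry hβ i j).hasFPowerSeriesAt.hasDerivAt.deriv]
  simp [FormalMultilinearSeries.ofScalars, xiCoeff]

/-- The matrix of the derivatives of the entries of `ξ'`. -/
def xiDeriv2 (β : ℕ → Fin m → ℝ) (A : Matrix (Fin m) (Fin m) ℝ) : Matrix (Fin m) (Fin m) ℝ :=
  Matrix.of fun i j => deriv (xiEntry β i j) (A i j)

lemma hasEntryDerivWithinAt_xiDeriv {β : ℕ → Fin m → ℝ} (hβ : IsMixture β)
    {U : ℝ → Matrix (Fin m) (Fin m) ℝ} {U' : Matrix (Fin m) (Fin m) ℝ} {s : Set ℝ} {t : ℝ}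
    (hU : HasEntryDerivWithinAt U U' s t) (hb : ∀ i j, U t i j ∈ Ioo (-(3 / 2) : ℝ) (3 / 2)) :
    HasEntryDerivWithinAt (fun r => xiDeriv β (U r)) (xiDeriv2 β (U t) ⊙ U') s t :=
  fun i j => HasDerivAt.comp_hasDerivWithinAt (h₂ := xiEntry β i j) t
    (hasDerivAt_xiEntry hβ i j (hb i j)) (hU i j)

/-! ### Differentiation under the integral sign -/

/-- The weight is merely integrable, as fits an order parameter. On the compact rectangle `φ'` is
bounded by some `C`, and `|w| * C` dominates. -/
lemma hasDerivAt_integral_mul {w : ℝ → ℝ} {φ φ' : ℝ → ℝ → ℝ} {a b r : ℝ} (hab : a ≤ b) (hr : 0 < r)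
    (hw : IntervalIntegrable w volume a b)
    (hφ : ∀ ε ∈ Ioo (-r) r, ContinuousOn (φ ε) (Icc a b))
    (hφ' : ContinuousOn (fun z : ℝ × ℝ => φ' z.1 z.2) (Icc (-r) r ×ˢ Icc a b))
    (hderiv : ∀ ε ∈ Ioo (-r) r, ∀ t ∈ Icc a b, HasDerivAt (fun e => φ e t) (φ' ε t) ε) :
    HasDerivAt (fun ε => ∫ t in a..b, w t * φ ε t) (∫ t in a..b, w t * φ' 0 t) 0 := by
  obtain ⟨C, hC⟩ := (isCompact_Icc.prod isCompact_Icc).exists_bound_of_continuousOn hφ'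
  have h0 : (0 : ℝ) ∈ Ioo (-r) r := ⟨by linarith, hr⟩
  have hsub : uIoc a b ⊆ Icc a b := by rw [uIoc_of_le hab]; exact Ioc_subset_Icc_self
  have hint : ∀ ε ∈ Ioo (-r) r, IntervalIntegrable (fun t => w t * φ ε t) volume a b := fun ε hε =>
    hw.mul_continuousOn (by rw [uIcc_of_le hab]; exact hφ ε hε)
  have hφ'0 : ContinuousOn (φ' 0) (Icc a b) :=
    hφ'.comp (f := fun t => ((0 : ℝ), t)) (by fun_prop) fun t ht => ⟨Ioo_subset_Icc_self h0, ht⟩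
  refine (intervalIntegral.hasDerivAt_integral_of_dominated_loc_of_deriv_le
    (bound := fun t => |w t| * C) (F' := fun ε t => w t * φ' ε t) (Ioo_mem_nhds h0.1 h0.2)
    ?_ (hint 0 h0) ?_ ?_ (hw.abs.mul_const C) ?_).2
  · filter_upwards [Ioo_mem_nhds h0.1 h0.2] with ε hε
    exact (intervalIntegrable_iff.1 (hint ε hε)).aestronglyMeasurable
  · exact (intervalIntegrable_iff.1 (hw.mul_continuousOn
      (by rw [uIcc_of_le hab]; exact hφ'0))).aestronglyMeasurable
  · refine Eventually.of_forall fun t ht ε hε => ?_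
    rw [norm_mul, Real.norm_eq_abs]
    gcongr
    exact hC (ε, t) ⟨Ioo_subset_Icc_self hε, hsub ht⟩
  · exact Eventually.of_forall fun t ht ε hε => (hderiv ε hε t (hsub ht)).const_mul _

/-- Compactness of `[a,b]` turns pointwise invertibility into invertibility uniform in small `ε`. -/
lemma exists_det_add_smul_ne_zero {U V : ℝ → Matrix (Fin m) (Fin m) ℝ} {a b : ℝ}
    (hU : ContinuousOn U (Icc a b)) (hV : ContinuousOn V (Icc a b))
    (hdet : ∀ t ∈ Icc a b, (U t).det ≠ 0) :
    ∃ r : ℝ, 0 < r ∧ ∀ ε ∈ Icc (-r) r, ∀ t ∈ Icc a b, (U t + ε • V t).det ≠ 0 := by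
  have hU' := continuousOn_iff_continuous_domRestrict.1 hU
  have hV' := continuousOn_iff_continuous_domRestrict.1 hV
  have hcont : Continuous fun z : ℝ × Icc a b => (U z.2 + z.1 • V z.2).det := by
    refine Continuous.matrix_det ?_
    exact (hU'.comp continuous_snd).add (continuous_fst.smul (hV'.comp continuous_snd))
  have hev : ∀ᶠ ε in 𝓝 (0 : ℝ), ∀ t ∈ (univ : Set (Icc a b)), (U t + ε • V t).det ≠ 0 := by
    refine isCompact_univ.eventually_forall_of_forall_eventually fun t _ => ?_
    refine hcont.continuousAt.eventually_ne ?_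
    simpa using hdet t t.2
  obtain ⟨r, hr, hball⟩ := Metric.eventually_nhds_iff.1 hev
  refine ⟨r / 2, by positivity, fun ε hε t ht => hball ?_ ⟨t, ht⟩ (mem_univ _)⟩
  rw [Real.dist_eq, sub_zero, abs_lt]
  constructor <;> linarith [hε.1, hε.2]

lemma ContinuousOn.pairing {X : Type*} [TopologicalSpace X] {s : Set X}
    {A B : X → Matrix (Fin m) (Fin m) ℝ} (hA : ContinuousOn A s) (hB : ContinuousOn B s) :
    ContinuousOn (fun z => VectorSpin.pairing (A z) (B z)) s :=
  (continuous_id.matrix_trace).comp_continuousOn (hA.mul hB)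

lemma ContinuousOn.matrixInv {X : Type*} [TopologicalSpace X] {s : Set X}
    {A : X → Matrix (Fin m) (Fin m) ℝ} (hA : ContinuousOn A s) (h : ∀ z ∈ s, (A z).det ≠ 0) :
    ContinuousOn (fun z => (A z)⁻¹) s := fun z hz =>
  (continuousAt_inv_of_det_ne_zero (h z hz)).comp_continuousWithinAt (hA z hz)

lemma hasEntryDerivWithinAt_add_smul (A B : Matrix (Fin m) (Fin m) ℝ) (s : Set ℝ) (ε : ℝ) :
    HasEntryDerivWithinAt (fun e : ℝ => A + e • B) B s ε := fun i j => by
  simpa using ((hasDerivWithinAt_id ε s).mul_const (B i j)).const_add (A i j)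

lemma hasDerivAt_integral_pairing_inv {U V W Y : ℝ → Matrix (Fin m) (Fin m) ℝ} {a b : ℝ}
    (hab : a ≤ b)
    (hU : ContinuousOn U (Icc a b)) (hV : ContinuousOn V (Icc a b))
    (hW : ContinuousOn W (Icc a b)) (hY : ContinuousOn Y (Icc a b))
    (hdet : ∀ t ∈ Icc a b, (U t).det ≠ 0) :
    HasDerivAt (fun ε : ℝ => ∫ t in a..b, pairing (U t + ε • V t)⁻¹ (W t + ε • Y t))
      (∫ t in a..b, (pairing (U t)⁻¹ (Y t) - pairing ((U t)⁻¹ * V t * (U t)⁻¹) (W t))) 0 := by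
  obtain ⟨r, hr, hne⟩ := exists_det_add_smul_ne_zero hU hV hdet
  have hsnd : MapsTo Prod.snd (Icc (-r) r ×ˢ Icc a b) (Icc a b) := fun z hz => hz.2
  have hlin : ∀ {A B : ℝ → Matrix (Fin m) (Fin m) ℝ}, ContinuousOn A (Icc a b) →
      ContinuousOn B (Icc a b) →
      ContinuousOn (fun z : ℝ × ℝ => A z.2 + z.1 • B z.2) (Icc (-r) r ×ˢ Icc a b) :=
    fun hA hB => (hA.comp continuousOn_snd hsnd).add
      (continuousOn_fst.smul (hB.comp continuousOn_snd hsnd))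
  have hinv : ContinuousOn (fun z : ℝ × ℝ => (U z.2 + z.1 • V z.2)⁻¹) (Icc (-r) r ×ˢ Icc a b) :=
    ContinuousOn.matrixInv (hlin hU hV) fun z hz => hne z.1 hz.1 z.2 hz.2
  have hslice : ∀ ε ∈ Ioo (-r) r, MapsTo (fun t : ℝ => (ε, t)) (Icc a b)
      (Icc (-r) r ×ˢ Icc a b) := fun ε hε t ht => ⟨Ioo_subset_Icc_self hε, ht⟩
  have hc : ContinuousOn (fun z : ℝ × ℝ => pairing (U z.2 + z.1 • V z.2)⁻¹ (W z.2 + z.1 • Y z.2))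
      (Icc (-r) r ×ˢ Icc a b) := ContinuousOn.pairing hinv (hlin hW hY)
  have hV2 : ContinuousOn (fun z : ℝ × ℝ => V z.2) (Icc (-r) r ×ˢ Icc a b) :=
    hV.comp continuousOn_snd hsnd
  have hY2 : ContinuousOn (fun z : ℝ × ℝ => Y z.2) (Icc (-r) r ×ˢ Icc a b) :=
    hY.comp continuousOn_snd hsnd
  have hinvV : ContinuousOn (fun z : ℝ × ℝ =>
      -((U z.2 + z.1 • V z.2)⁻¹ * V z.2 * (U z.2 + z.1 • V z.2)⁻¹)) (Icc (-r) r ×ˢ Icc a b) :=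
    ((hinv.mul hV2).mul hinv).neg
  have hc' : ContinuousOn (fun z : ℝ × ℝ =>
      pairing (-((U z.2 + z.1 • V z.2)⁻¹ * V z.2 * (U z.2 + z.1 • V z.2)⁻¹)) (W z.2 + z.1 • Y z.2)
      + pairing (U z.2 + z.1 • V z.2)⁻¹ (Y z.2)) (Icc (-r) r ×ˢ Icc a b) :=
    (ContinuousOn.pairing hinvV (hlin hW hY)).add (ContinuousOn.pairing hinv hY2)
  have hder : ∀ ε ∈ Ioo (-r) r, ∀ t ∈ Icc a b,
      HasDerivAt (fun e : ℝ => pairing (U t + e • V t)⁻¹ (W t + e • Y t))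
        (pairing (-((U t + ε • V t)⁻¹ * V t * (U t + ε • V t)⁻¹)) (W t + ε • Y t)
          + pairing (U t + ε • V t)⁻¹ (Y t)) ε := fun ε hε t ht => by
    have h1 := (hasEntryDerivWithinAt_add_smul (U t) (V t) univ ε).inv
      (hne ε (Ioo_subset_Icc_self hε) t ht)
    have h2 := hasEntryDerivWithinAt_add_smul (W t) (Y t) univ ε
    exact hasDerivWithinAt_univ.1 (h1.pairing h2)
  have key := hasDerivAt_integral_mul (w := fun _ => 1)
    (φ := fun ε t => pairing (U t + ε • V t)⁻¹ (W t + ε • Y t))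
    (φ' := fun ε t => pairing (-((U t + ε • V t)⁻¹ * V t * (U t + ε • V t)⁻¹)) (W t + ε • Y t)
      + pairing (U t + ε • V t)⁻¹ (Y t)) hab hr intervalIntegrable_const
    (fun ε hε => ContinuousOn.comp (f := fun t : ℝ => (ε, t)) hc (by fun_prop) (hslice ε hε))
    hc' hder
  simp only [one_mul, zero_smul, add_zero] at key
  convert key using 1
  refine intervalIntegral.integral_congr fun t _ => ?_
  simp only [pairing, Matrix.neg_mul, Matrix.trace_neg]
  ring

lemma hasDerivAt_integral_pairing_xiDeriv {β : ℕ → Fin m → ℝ} (hβ : IsMixture β)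
    (H : Matrix (Fin m) (Fin m) ℝ) {w : ℝ → ℝ}
    {A B W Y : ℝ → Matrix (Fin m) (Fin m) ℝ} {a b : ℝ} (hab : a ≤ b)
    (hw : IntervalIntegrable w volume a b)
    (hA : ContinuousOn A (Icc a b)) (hB : ContinuousOn B (Icc a b))
    (hW : ContinuousOn W (Icc a b)) (hY : ContinuousOn Y (Icc a b))
    (hA1 : ∀ t ∈ Icc a b, ∀ i j, |A t i j| ≤ 1) :
    HasDerivAt (fun ε : ℝ => ∫ t in a..b,
        w t * pairing (xiDeriv β (A t + ε • B t) + H) (W t + ε • Y t))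
      (∫ t in a..b, w t *
        (pairing (xiDeriv2 β (A t) ⊙ B t) (W t) + pairing (xiDeriv β (A t) + H) (Y t))) 0 := by
  obtain ⟨C, hC⟩ : ∃ C, ∀ t ∈ Icc a b, ∀ i j, |B t i j| ≤ C := by
    have : ContinuousOn (fun t => ∑ i, ∑ j, |B t i j|) (Icc a b) :=
      continuousOn_finsetSum _ fun i _ => continuousOn_finsetSum _ fun j _ =>
        (continuousOn_pi.1 (continuousOn_pi.1 hB i) j).abs
    obtain ⟨C, hC⟩ := isCompact_Icc.exists_bound_of_continuousOn this
    refine ⟨C, fun t ht i j => le_trans ?_ ((le_abs_self _).trans (hC t ht))⟩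
    refine le_trans ?_ (Finset.single_le_sum (f := fun i => ∑ j, |B t i j|)
      (fun i _ => Finset.sum_nonneg fun j _ => abs_nonneg _) (Finset.mem_univ i))
    exact Finset.single_le_sum (f := fun j => |B t i j|) (fun j _ => abs_nonneg _)
      (Finset.mem_univ j)
  -- This radius keeps `|ε B|` at most `1/4`, so the perturbed entries stay within `5/4`, inside the
  -- interval of analyticity.
  set r : ℝ := 1 / (4 * (|C| + 1)) with hrdef
  have hr : 0 < r := by positivity
  have hrC : r * |C| ≤ 1 / 4 := by
    rw [hrdef, div_mul_eq_mul_div, div_le_div_iff₀ (by positivity) (by norm_num)]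
    linarith [abs_nonneg C]
  have hmem : ∀ ε ∈ Icc (-r) r, ∀ t ∈ Icc a b, ∀ i j,
      (A t + ε • B t) i j ∈ Ioo (-(3 / 2) : ℝ) (3 / 2) := by
    intro ε hε t ht i j
    have h1 := hA1 t ht i j
    have h2 : |ε * B t i j| ≤ 1 / 4 := by
      rw [abs_mul]
      refine le_trans ?_ hrC
      exact mul_le_mul (abs_le.2 hε) ((hC t ht i j).trans (le_abs_self C)) (abs_nonneg _) hr.le
    rw [abs_le] at h1 h2
    simp only [Matrix.add_apply, Matrix.smul_apply, smul_eq_mul]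
    constructor <;> linarith [h1.1, h1.2, h2.1, h2.2]
  have hsnd : MapsTo Prod.snd (Icc (-r) r ×ˢ Icc a b) (Icc a b) := fun z hz => hz.2
  have hlin : ∀ {A B : ℝ → Matrix (Fin m) (Fin m) ℝ}, ContinuousOn A (Icc a b) →
      ContinuousOn B (Icc a b) →
      ContinuousOn (fun z : ℝ × ℝ => A z.2 + z.1 • B z.2) (Icc (-r) r ×ˢ Icc a b) :=
    fun hA hB => (hA.comp continuousOn_snd hsnd).add
      (continuousOn_fst.smul (hB.comp continuousOn_snd hsnd))
  have hentry : ∀ i j, ContinuousOn (fun z : ℝ × ℝ => (A z.2 + z.1 • B z.2) i j)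
      (Icc (-r) r ×ˢ Icc a b) := fun i j => continuousOn_pi.1 (continuousOn_pi.1 (hlin hA hB) i) j
  have hxi : ContinuousOn (fun z : ℝ × ℝ => xiDeriv β (A z.2 + z.1 • B z.2))
      (Icc (-r) r ×ˢ Icc a b) :=
    continuousOn_pi.2 fun i => continuousOn_pi.2 fun j =>
      (continuousOn_xiEntry hβ i j).comp (hentry i j) fun z hz => hmem z.1 hz.1 z.2 hz.2 i j
  have hxi2 : ContinuousOn (fun z : ℝ × ℝ => xiDeriv2 β (A z.2 + z.1 • B z.2) ⊙ B z.2)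
      (Icc (-r) r ×ˢ Icc a b) :=
    continuousOn_pi.2 fun i => continuousOn_pi.2 fun j =>
      ((continuousOn_deriv_xiEntry hβ i j).comp (hentry i j)
        fun z hz => hmem z.1 hz.1 z.2 hz.2 i j).mul
        (continuousOn_pi.1 (continuousOn_pi.1 (hB.comp continuousOn_snd hsnd) i) j)
  have hslice : ∀ ε ∈ Ioo (-r) r, MapsTo (fun t : ℝ => (ε, t)) (Icc a b)
      (Icc (-r) r ×ˢ Icc a b) := fun ε hε t ht => ⟨Ioo_subset_Icc_self hε, ht⟩
  have hxiH := hxi.add (continuousOn_const (c := H))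
  have hY2 : ContinuousOn (fun z : ℝ × ℝ => Y z.2) (Icc (-r) r ×ˢ Icc a b) :=
    hY.comp continuousOn_snd hsnd
  have hc : ContinuousOn (fun z : ℝ × ℝ =>
      pairing (xiDeriv β (A z.2 + z.1 • B z.2) + H) (W z.2 + z.1 • Y z.2))
      (Icc (-r) r ×ˢ Icc a b) := ContinuousOn.pairing hxiH (hlin hW hY)
  have hc' : ContinuousOn (fun z : ℝ × ℝ =>
      pairing (xiDeriv2 β (A z.2 + z.1 • B z.2) ⊙ B z.2) (W z.2 + z.1 • Y z.2)
      + pairing (xiDeriv β (A z.2 + z.1 • B z.2) + H) (Y z.2)) (Icc (-r) r ×ˢ Icc a b) :=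
    (ContinuousOn.pairing hxi2 (hlin hW hY)).add (ContinuousOn.pairing hxiH hY2)
  have hder : ∀ ε ∈ Ioo (-r) r, ∀ t ∈ Icc a b,
      HasDerivAt (fun e : ℝ => pairing (xiDeriv β (A t + e • B t) + H) (W t + e • Y t))
        (pairing (xiDeriv2 β (A t + ε • B t) ⊙ B t) (W t + ε • Y t)
          + pairing (xiDeriv β (A t + ε • B t) + H) (Y t)) ε := fun ε hε t ht => by
    have h1 : HasEntryDerivWithinAt (fun e : ℝ => xiDeriv β (A t + e • B t) + H)
        (xiDeriv2 β (A t + ε • B t) ⊙ B t) univ ε := fun i j =>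
      ((hasEntryDerivWithinAt_xiDeriv hβ (hasEntryDerivWithinAt_add_smul (A t) (B t) univ ε)
        (hmem ε (Ioo_subset_Icc_self hε) t ht)) i j).add_const _
    have h2 := hasEntryDerivWithinAt_add_smul (W t) (Y t) univ ε
    exact hasDerivWithinAt_univ.1 (h1.pairing h2)
  have key := hasDerivAt_integral_mul (w := w)
    (φ := fun ε t => pairing (xiDeriv β (A t + ε • B t) + H) (W t + ε • Y t))
    (φ' := fun ε t => pairing (xiDeriv2 β (A t + ε • B t) ⊙ B t) (W t + ε • Y t)
      + pairing (xiDeriv β (A t + ε • B t) + H) (Y t)) hab hr hw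
    (fun ε hε => ContinuousOn.comp (f := fun t : ℝ => (ε, t)) hc (by fun_prop) (hslice ε hε))
    hc' hder
  simpa only [zero_smul, add_zero] using key

/-! ### Tail integrals of matrix-valued functions -/

/-- The matrix-valued integral `∫_t^m k(s) Y(s) ds`. -/
def tailIntegral (k : ℝ → ℝ) (Y : ℝ → Matrix (Fin m) (Fin m) ℝ) (t : ℝ) :
    Matrix (Fin m) (Fin m) ℝ :=
  Matrix.of fun i j => ∫ s in t..(m : ℝ), k s * Y s i j

lemma continuousOn_entry {X : Type*} [TopologicalSpace X] {s : Set X}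
    {Y : X → Matrix (Fin m) (Fin m) ℝ} (hY : ContinuousOn Y s) (i j : Fin m) :
    ContinuousOn (fun z => Y z i j) s :=
  continuousOn_pi.1 (continuousOn_pi.1 hY i) j

lemma intervalIntegrable_mul {k g : ℝ → ℝ} {c : ℝ} (hc : 0 ≤ c)
    (hk : IntervalIntegrable k volume 0 c) (hg : ContinuousOn g (Icc 0 c)) {a b : ℝ}
    (ha : a ∈ Icc 0 c) (hb : b ∈ Icc 0 c) :
    IntervalIntegrable (fun s => k s * g s) volume a b := by
  rw [← uIcc_of_le hc] at hg ha hb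
  exact (hk.mul_continuousOn hg).mono_set (uIcc_subset_uIcc ha hb)

section TailIntegral

variable {k : ℝ → ℝ} {Y : ℝ → Matrix (Fin m) (Fin m) ℝ}

lemma continuousOn_tailIntegral (hk : IntervalIntegrable k volume 0 m)
    (hY : ContinuousOn Y (Icc 0 (m : ℝ))) : ContinuousOn (tailIntegral k Y) (Icc 0 (m : ℝ)) := by
  have hm0 : (0 : ℝ) ≤ m := by positivity
  refine continuousOn_pi.2 fun i => continuousOn_pi.2 fun j => ?_
  rw [← uIcc_of_le hm0]
  refine intervalIntegral.continuousOn_primitive_interval_left ?_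
  rw [uIcc_of_le hm0, ← intervalIntegrable_iff_integrableOn_Icc_of_le hm0]
  exact intervalIntegrable_mul hm0 hk (continuousOn_entry hY i j) ⟨le_rfl, hm0⟩ ⟨hm0, le_rfl⟩

/-- Only a right derivative is available, since `k` may jump; the integrations by parts below use
the fundamental theorem in its right-derivative form. -/
lemma hasEntryDerivWithinAt_tailIntegral (hk : IntervalIntegrable k volume 0 m)
    (hY : ContinuousOn Y (Icc 0 (m : ℝ))) {t : ℝ} (ht : t ∈ Ico 0 (m : ℝ))
    (hr : ContinuousWithinAt k (Ici t) t) :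
    HasEntryDerivWithinAt (tailIntegral k Y) (-(k t • Y t)) (Ioi t) t := by
  intro i j
  have hm0 : (0 : ℝ) ≤ m := ht.1.trans ht.2.le
  have hint : IntervalIntegrable (fun s => k s * Y s i j) volume t m :=
    intervalIntegrable_mul hm0 hk (continuousOn_entry hY i j) ⟨ht.1, ht.2.le⟩ ⟨hm0, le_rfl⟩
  have hYr : ContinuousWithinAt (fun s => Y s i j) (Ioi t) t :=
    (continuousOn_entry hY i j t ⟨ht.1, ht.2.le⟩).mono_of_mem_nhdsWithin
      (mem_of_superset (Ioo_mem_nhdsGT ht.2) fun s hs => ⟨ht.1.trans hs.1.le, hs.2.le⟩)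
  have h := intervalIntegral.integral_hasDerivWithinAt_left (s := Ici t) (t := Ioi t) hint
    (AEStronglyMeasurable.stronglyMeasurableAtFilter_of_mem
      ((intervalIntegrable_iff_integrableOn_Ioo_of_le ht.2.le).1 hint).aestronglyMeasurable
      (Ioo_mem_nhdsGT ht.2))
    ((hr.mono Ioi_subset_Ici_self).mul hYr)
  exact (h.mono Ioi_subset_Ici_self).congr_deriv (by simp)

lemma tailIntegral_eq_zero {q t : ℝ} (hqt : q ≤ t) (htm : t ≤ m)
    (h : ∀ s ∈ Icc q (m : ℝ), k s • Y s = 0) : tailIntegral k Y t = 0 := by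
  ext i j
  simp only [tailIntegral, Matrix.of_apply, Matrix.zero_apply]
  refine (intervalIntegral.integral_congr fun s hs => ?_).trans intervalIntegral.integral_zero
  rw [uIcc_of_le htm] at hs
  simpa using congrFun (congrFun (h s ⟨hqt.trans hs.1, hs.2⟩) i) j

end TailIntegral

/-- The primitive of a continuous function is differentiable within the interval. -/
lemma hasDerivWithinAt_primitive {g : ℝ → ℝ} {T t : ℝ} (hg : ContinuousOn g (Icc 0 T))
    (ht : t ∈ Icc 0 T) :
    HasDerivWithinAt (fun u => ∫ s in (0 : ℝ)..u, g s) (g t) (Icc 0 T) t := by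
  have := Fact.mk ht
  refine intervalIntegral.integral_hasDerivWithinAt_right (s := Icc 0 T) (t := Icc 0 T) ?_
    (hg.stronglyMeasurableAtFilter_nhdsWithin measurableSet_Icc t) (hg t ht)
  refine ContinuousOn.intervalIntegrable ?_
  rw [uIcc_of_le ht.1]
  exact hg.mono (Icc_subset_Icc_right ht.2)

/-! ### Regular pairs -/

/-- A pair `(x, Φ)` with continuously differentiable path, together with a cut-off `T` that is
also seen by the trace of `Φ`. -/
structure IsRegularPair (Q : Matrix (Fin m) (Fin m) ℝ) (x : ℝ → ℝ)
    (Φ : ℝ → Matrix (Fin m) (Fin m) ℝ) (T : ℝ) : Prop where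
  one_le : 1 ≤ m
  constraint : IsConstraint Q
  orderParameter : IsOrderParameter m x
  path : IsMonotonePath Q Φ
  differentiable : ∀ i j, DifferentiableOn ℝ (fun t => Φ t i j) (Icc 0 (m : ℝ))
  continuousOn_deriv : ContinuousOn (pathDeriv Φ) (Icc 0 (m : ℝ))
  cutoff : IsCutoff Q x Φ T
  trace_lt : (Φ (topPoint m x)).trace < (Φ T).trace

/-- The trace may be flat just after the top point. The last time `T0` with the same trace has the
same matrix, hence still a positive determinant; any slightly later `T` keeps it positive and has
strictly larger trace. -/
lemma IsMinimizer.exists_isRegularPair (hm : 1 ≤ m) {Q : Matrix (Fin m) (Fin m) ℝ}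
    (hQ : IsConstraint Q) {β : ℕ → Fin m → ℝ} {h : Fin m → ℝ} {x : ℝ → ℝ} {μ : Measure ℝ}
    {Φ : ℝ → Matrix (Fin m) (Fin m) ℝ} (hmin : IsMinimizer β h Q x μ Φ) :
    ∃ T, IsRegularPair Q x Φ T := by
  have hΦ := hmin.path.toIsMonotonePath
  have hd := hmin.path.differentiable
  have htop := topPoint_mem hmin.orderParameter
  have hτ := trace_mem hQ hΦ htop
  have hT0 := traceInv_mem hΦ hτ
  have hΦT0 := path_traceInv_trace hQ hΦ hd htop
  have htopT0 : topPoint m x ≤ traceInv Φ (Φ (topPoint m x)).trace :=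
    (le_traceInv_iff hΦ hd hτ htop).2 le_rfl
  set T0 := traceInv Φ (Φ (topPoint m x)).trace
  have hdet0 : 0 < (Q - Φ T0).det := by rw [hΦT0]; exact hmin.det_pos
  have hT0m : T0 < m := by
    refine hT0.2.lt_of_ne fun heq => ?_
    have : Nonempty (Fin m) := ⟨⟨0, hm⟩⟩
    rw [heq, hΦ.right_end, sub_self, Matrix.det_zero] at hdet0
    exact lt_irrefl _ hdet0
  have hcont : ContinuousOn (fun t => (Q - Φ t).det) (Icc 0 (m : ℝ)) :=
    continuous_id.matrix_det.comp_continuousOn (continuousOn_const.sub (continuousOn_path hd))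
  have hev : ∀ᶠ t in 𝓝[>] T0, 0 < (Q - Φ t).det := by
    have h1 : Tendsto (fun t => (Q - Φ t).det) (𝓝[>] T0) (𝓝 (Q - Φ T0).det) :=
      (hcont T0 hT0).mono_of_mem_nhdsWithin (mem_of_superset (Ioo_mem_nhdsGT hT0m)
        fun s hs => ⟨hT0.1.trans hs.1.le, hs.2.le⟩)
    exact h1.eventually (lt_mem_nhds hdet0)
  obtain ⟨T, hT, hTdet⟩ := (Filter.Eventually.and (Ioo_mem_nhdsGT hT0m) hev).exists
  have hTI : T ∈ Icc 0 (m : ℝ) := ⟨hT0.1.trans hT.1.le, hT.2.le⟩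
  refine ⟨T, hm, hQ, hmin.orderParameter, hΦ, hd, ?_, ⟨htopT0.trans_lt hT.1, hT.2, hTdet⟩, ?_⟩
  · obtain ⟨K, hK⟩ := hmin.path.lipschitz_deriv
    exact continuousOn_pi.2 fun i => continuousOn_pi.2 fun j => (hK i j).continuousOn
  · by_contra hcon
    exact absurd ((le_traceInv_iff hΦ hd hτ hTI).2 (not_lt.1 hcon)) (not_le.2 hT.1)

lemma IsOrderParameter.intervalIntegrable {x : ℝ → ℝ} (hx : IsOrderParameter m x) :
    IntervalIntegrable x volume 0 m :=
  MonotoneOn.intervalIntegrable (by rw [uIcc_of_le (by positivity)]; exact hx.monotoneOn)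

namespace IsRegularPair

variable {Q : Matrix (Fin m) (Fin m) ℝ} {x : ℝ → ℝ} {Φ : ℝ → Matrix (Fin m) (Fin m) ℝ} {T : ℝ}

lemma cutoff_mem (hp : IsRegularPair Q x Φ T) : T ∈ Ioo 0 (m : ℝ) :=
  ⟨(topPoint_mem hp.orderParameter).1.trans_lt hp.cutoff.1, hp.cutoff.2.1⟩

lemma Icc_subset (hp : IsRegularPair Q x Φ T) : Icc 0 T ⊆ Icc 0 (m : ℝ) :=
  Icc_subset_Icc_right hp.cutoff_mem.2.le

lemma abs_apply_le_one (hp : IsRegularPair Q x Φ T) {t : ℝ} (ht : t ∈ Icc 0 (m : ℝ))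
    (i j : Fin m) : |Φ t i j| ≤ 1 := by
  have hdiag : ∀ k, Φ t k k ≤ 1 := fun k => by
    have := (hp.path.monotone t ht m ⟨ht.1.trans ht.2, le_rfl⟩ ht.2).diag_nonneg (i := k)
    rw [hp.path.right_end, Matrix.sub_apply, hp.constraint.diag] at this
    linarith
  have := abs_apply_le_half_add (hp.path.posSemidef t ht) i j
  linarith [hdiag i, hdiag j]

/-- Past the top point `x` is identically `1`, so the tail integral is the plain increment of the
path. -/
lemma hatPath_eq (hp : IsRegularPair Q x Φ T) : hatPath x Φ T = Q - Φ T := by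
  have hT := hp.cutoff_mem
  have hsub : Icc T m ⊆ Icc 0 (m : ℝ) := Icc_subset_Icc_left hT.1.le
  ext i j
  have hc := continuousOn_entry hp.continuousOn_deriv i j
  have h1 : ∫ s in T..(m : ℝ), x s * pathDeriv Φ s i j = ∫ s in T..(m : ℝ), pathDeriv Φ s i j := by
    refine intervalIntegral.integral_congr fun s hs => ?_
    rw [uIcc_of_le hT.2.le] at hs
    simp only [eq_one_of_topPoint_lt hp.orderParameter (hsub hs) (hp.cutoff.1.trans_le hs.1),
      one_mul]
  rw [hatPath, Matrix.of_apply, h1, intervalIntegral.integral_eq_sub_of_hasDerivAt_of_le hT.2.le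
    ((hp.differentiable i j).continuousOn.mono hsub)
    (fun s hs => hasDerivAt_path hp.differentiable ⟨hT.1.trans hs.1, hs.2⟩ i j)
    ((hc.mono hsub).intervalIntegrable_of_Icc hT.2.le), hp.path.right_end, Matrix.sub_apply]

lemma posSemidef_hatPath_sub (hp : IsRegularPair Q x Φ T) {s t : ℝ} (hs : s ∈ Icc 0 (m : ℝ))
    (ht : t ∈ Icc 0 (m : ℝ)) (hst : s ≤ t) : (hatPath x Φ s - hatPath x Φ t).PosSemidef := by
  have hm0 : (0 : ℝ) ≤ m := hs.1.trans hs.2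
  have hmI : (m : ℝ) ∈ Icc 0 (m : ℝ) := ⟨hm0, le_rfl⟩
  have hint : ∀ i j {a b : ℝ}, a ∈ Icc 0 (m : ℝ) → b ∈ Icc 0 (m : ℝ) →
      IntervalIntegrable (fun s => x s * pathDeriv Φ s i j) volume a b := fun i j _ _ ha hb =>
    intervalIntegrable_mul hm0 hp.orderParameter.intervalIntegrable
      (continuousOn_entry hp.continuousOn_deriv i j) ha hb
  have hentry : ∀ i j, (hatPath x Φ s - hatPath x Φ t) i j
      = ∫ u in s..t, x u * pathDeriv Φ u i j := fun i j => by
    rw [Matrix.sub_apply, hatPath, hatPath, Matrix.of_apply, Matrix.of_apply, sub_eq_iff_eq_add]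
    exact (intervalIntegral.integral_add_adjacent_intervals (hint i j hs ht)
      (hint i j ht hmI)).symm
  have hpsd : ∀ u ∈ Icc s t, (pathDeriv Φ u).PosSemidef := fun u hu =>
    posSemidef_pathDeriv hp.one_le hp.path hp.differentiable ⟨hs.1.trans hu.1, hu.2.trans ht.2⟩
  refine .of_dotProduct_mulVec_nonneg ?_ fun v => ?_
  · ext i j
    rw [Matrix.conjTranspose_apply, star_trivial, hentry, hentry]
    refine intervalIntegral.integral_congr fun u hu => ?_
    rw [uIcc_of_le hst] at hu
    have : pathDeriv Φ u j i = pathDeriv Φ u i j := by simpa using (hpsd u hu).1.apply i j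
    simp only [this]
  · have hI : ∀ i j, IntervalIntegrable (fun u => v i * v j * (x u * pathDeriv Φ u i j))
        volume s t := fun i j => (hint i j hs ht).const_mul _
    have hI2 : ∀ i, IntervalIntegrable (fun u => ∑ j, v i * v j * (x u * pathDeriv Φ u i j))
        volume s t := fun i => by
      have := IntervalIntegrable.sum Finset.univ fun j _ => hI i j
      rwa [Finset.sum_fn] at this
    have e : star v ⬝ᵥ ((hatPath x Φ s - hatPath x Φ t) *ᵥ v)
        = ∫ u in s..t, x u * (star v ⬝ᵥ (pathDeriv Φ u *ᵥ v)) := by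
      simp only [quad_eq_sum, hentry, ← intervalIntegral.integral_const_mul]
      simp only [← intervalIntegral.integral_finsetSum fun j _ => hI _ j]
      rw [← intervalIntegral.integral_finsetSum fun i _ => hI2 i]
      refine intervalIntegral.integral_congr fun u _ => ?_
      simp only [Finset.mul_sum]
      exact Finset.sum_congr rfl fun i _ => Finset.sum_congr rfl fun j _ => by ring
    rw [e]
    exact intervalIntegral.integral_nonneg hst fun u hu =>
      mul_nonneg (hp.orderParameter.nonneg u ⟨hs.1.trans hu.1, hu.2.trans ht.2⟩)
        ((hpsd u hu).dotProduct_mulVec_nonneg v)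

/-- `Φ̂` decreases in `t` and equals the positive definite matrix `Q - Φ T` at the cut-off. -/
lemma posDef_hatPath (hp : IsRegularPair Q x Φ T) {t : ℝ} (ht : t ∈ Icc 0 T) :
    (hatPath x Φ t).PosDef := by
  have hT := Ioo_subset_Icc_self hp.cutoff_mem
  have hmI : (m : ℝ) ∈ Icc 0 (m : ℝ) := ⟨hT.1.trans hT.2, le_rfl⟩
  refine posDef_of_le ?_ hp.cutoff.2.2 (hp.hatPath_eq ▸
    hp.posSemidef_hatPath_sub (hp.Icc_subset ht) hT ht.2)
  exact hp.path.right_end ▸ hp.path.monotone T hT m hmI hT.2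

lemma det_hatPath_ne_zero (hp : IsRegularPair Q x Φ T) {t : ℝ} (ht : t ∈ Icc 0 T) :
    (hatPath x Φ t).det ≠ 0 :=
  (hp.posDef_hatPath ht).det_pos.ne'

lemma continuousOn_hatPath (hp : IsRegularPair Q x Φ T) :
    ContinuousOn (hatPath x Φ) (Icc 0 (m : ℝ)) :=
  continuousOn_tailIntegral hp.orderParameter.intervalIntegrable hp.continuousOn_deriv

lemma hasEntryDerivWithinAt_hatPath (hp : IsRegularPair Q x Φ T) {t : ℝ}
    (ht : t ∈ Ico 0 (m : ℝ)) :
    HasEntryDerivWithinAt (hatPath x Φ) (-(x t • pathDeriv Φ t)) (Ioi t) t :=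
  hasEntryDerivWithinAt_tailIntegral hp.orderParameter.intervalIntegrable hp.continuousOn_deriv ht
    (hp.orderParameter.rightContinuous t ht)

end IsRegularPair

/-! ### The first variation of the functional -/

/-- The integrand `Φ̂⁻¹ Φ' Φ̂⁻¹`. -/
def sandwich (x : ℝ → ℝ) (Φ : ℝ → Matrix (Fin m) (Fin m) ℝ) (t : ℝ) : Matrix (Fin m) (Fin m) ℝ :=
  (hatPath x Φ t)⁻¹ * pathDeriv Φ t * (hatPath x Φ t)⁻¹

/-- The matrix `∫_0^t Φ̂⁻¹ Φ' Φ̂⁻¹`. -/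
def sandwichIntegral (x : ℝ → ℝ) (Φ : ℝ → Matrix (Fin m) (Fin m) ℝ) (t : ℝ) :
    Matrix (Fin m) (Fin m) ℝ :=
  Matrix.of fun i j => ∫ s in (0 : ℝ)..t, sandwich x Φ s i j

/-- The matrix `ξ'(Φ(t)) - ∫_0^t Φ̂⁻¹ Φ' Φ̂⁻¹`, whose sum with `h hᵀ` is the gradient of the
functional. -/
def gradient (β : ℕ → Fin m → ℝ) (x : ℝ → ℝ) (Φ : ℝ → Matrix (Fin m) (Fin m) ℝ) (t : ℝ) :
    Matrix (Fin m) (Fin m) ℝ :=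
  xiDeriv β (Φ t) - sandwichIntegral x Φ t

/-- The derivative of `gradient`. -/
def gradientDeriv (β : ℕ → Fin m → ℝ) (x : ℝ → ℝ) (Φ : ℝ → Matrix (Fin m) (Fin m) ℝ) (t : ℝ) :
    Matrix (Fin m) (Fin m) ℝ :=
  xiDeriv2 β (Φ t) ⊙ pathDeriv Φ t - sandwich x Φ t

lemma sandwichIntegral_zero (x : ℝ → ℝ) (Φ : ℝ → Matrix (Fin m) (Fin m) ℝ) :
    sandwichIntegral x Φ 0 = 0 := by
  ext i j; simp [sandwichIntegral]

lemma pairing_sandwich_swap (U V W : Matrix (Fin m) (Fin m) ℝ) :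
    pairing (U * V * U) W = pairing (U * W * U) V := by
  rw [pairing, pairing, Matrix.mul_assoc, Matrix.mul_assoc, Matrix.trace_mul_comm,
    Matrix.mul_assoc, Matrix.mul_assoc, Matrix.trace_mul_comm, ← Matrix.mul_assoc,
    Matrix.mul_assoc, Matrix.mul_assoc]

lemma nonneg_of_hasDerivAt_of_le {E : ℝ → ℝ} {E' : ℝ} (hE : HasDerivAt E E' 0)
    (h : ∀ ε ∈ Icc (0 : ℝ) 1, E 0 ≤ E ε) : 0 ≤ E' := by
  have h1 := (hasDerivWithinAt_iff_tendsto_slope' (s := Ioi (0 : ℝ)) (by simp)).1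
    hE.hasDerivWithinAt
  refine ge_of_tendsto h1 ?_
  filter_upwards [Ioo_mem_nhdsGT one_pos] with ε hε
  rw [slope_def_field]
  exact div_nonneg (sub_nonneg.2 (h ε ⟨hε.1.le, hε.2.le⟩)) (by linarith [hε.1])

namespace IsRegularPair

variable {Q : Matrix (Fin m) (Fin m) ℝ} {x : ℝ → ℝ} {Φ : ℝ → Matrix (Fin m) (Fin m) ℝ} {T : ℝ}

lemma continuousOn_inv_hatPath (hp : IsRegularPair Q x Φ T) :
    ContinuousOn (fun t => (hatPath x Φ t)⁻¹) (Icc 0 T) :=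
  ContinuousOn.matrixInv (hp.continuousOn_hatPath.mono hp.Icc_subset)
    fun _ ht => hp.det_hatPath_ne_zero ht

lemma continuousOn_sandwich (hp : IsRegularPair Q x Φ T) :
    ContinuousOn (sandwich x Φ) (Icc 0 T) :=
  (hp.continuousOn_inv_hatPath.mul (hp.continuousOn_deriv.mono hp.Icc_subset)).mul
    hp.continuousOn_inv_hatPath

lemma hasEntryDerivWithinAt_sandwichIntegral (hp : IsRegularPair Q x Φ T) {t : ℝ}
    (ht : t ∈ Icc 0 T) :
    HasEntryDerivWithinAt (sandwichIntegral x Φ) (sandwich x Φ t) (Icc 0 T) t := fun i j =>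
  hasDerivWithinAt_primitive (continuousOn_entry hp.continuousOn_sandwich i j) ht

lemma continuousOn_sandwichIntegral (hp : IsRegularPair Q x Φ T) :
    ContinuousOn (sandwichIntegral x Φ) (Icc 0 T) := fun _ ht =>
  (hp.hasEntryDerivWithinAt_sandwichIntegral ht).continuousWithinAt

lemma hasEntryDerivWithinAt_path (hp : IsRegularPair Q x Φ T) {t : ℝ} (ht : t ∈ Icc 0 (m : ℝ)) :
    HasEntryDerivWithinAt Φ (pathDeriv Φ t) (Icc 0 (m : ℝ)) t := fun i j =>
  hasDerivWithinAt_path hp.differentiable ht i j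

lemma entry_mem_Ioo (hp : IsRegularPair Q x Φ T) {t : ℝ} (ht : t ∈ Icc 0 (m : ℝ)) (i j : Fin m) :
    Φ t i j ∈ Ioo (-(3 / 2) : ℝ) (3 / 2) := by
  have := abs_le.1 (hp.abs_apply_le_one ht i j)
  exact ⟨by linarith [this.1], by linarith [this.2]⟩

lemma hasEntryDerivWithinAt_gradient (hp : IsRegularPair Q x Φ T) {β : ℕ → Fin m → ℝ}
    (hβ : IsMixture β) {t : ℝ} (ht : t ∈ Icc 0 T) :
    HasEntryDerivWithinAt (gradient β x Φ) (gradientDeriv β x Φ t) (Icc 0 T) t :=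
  ((hasEntryDerivWithinAt_xiDeriv hβ (hp.hasEntryDerivWithinAt_path (hp.Icc_subset ht))
    (hp.entry_mem_Ioo (hp.Icc_subset ht))).mono hp.Icc_subset).sub
    (hp.hasEntryDerivWithinAt_sandwichIntegral ht)

lemma continuousOn_xiDeriv (hp : IsRegularPair Q x Φ T) {β : ℕ → Fin m → ℝ}
    (hβ : IsMixture β) : ContinuousOn (fun t => xiDeriv β (Φ t)) (Icc 0 (m : ℝ)) := fun _ ht =>
  (hasEntryDerivWithinAt_xiDeriv hβ (hp.hasEntryDerivWithinAt_path ht)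
    (hp.entry_mem_Ioo ht)).continuousWithinAt

lemma continuousOn_xiDeriv2_hadamard (hp : IsRegularPair Q x Φ T) {β : ℕ → Fin m → ℝ}
    (hβ : IsMixture β) {Y : ℝ → Matrix (Fin m) (Fin m) ℝ} (hY : ContinuousOn Y (Icc 0 (m : ℝ))) :
    ContinuousOn (fun t => xiDeriv2 β (Φ t) ⊙ Y t) (Icc 0 (m : ℝ)) :=
  continuousOn_pi.2 fun i => continuousOn_pi.2 fun j =>
    ((continuousOn_deriv_xiEntry hβ i j).comp (hp.differentiable i j).continuousOn
      fun _ ht => hp.entry_mem_Ioo ht i j).mul (continuousOn_entry hY i j)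

lemma continuousOn_gradient (hp : IsRegularPair Q x Φ T) {β : ℕ → Fin m → ℝ}
    (hβ : IsMixture β) : ContinuousOn (gradient β x Φ) (Icc 0 T) := fun _ ht =>
  (hp.hasEntryDerivWithinAt_gradient hβ ht).continuousWithinAt

lemma continuousOn_gradientDeriv (hp : IsRegularPair Q x Φ T) {β : ℕ → Fin m → ℝ}
    (hβ : IsMixture β) : ContinuousOn (gradientDeriv β x Φ) (Icc 0 T) :=
  ((hp.continuousOn_xiDeriv2_hadamard hβ hp.continuousOn_deriv).mono hp.Icc_subset).sub
    hp.continuousOn_sandwich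

end IsRegularPair

lemma integral_eq_integral_of_eq_zero {g : ℝ → ℝ} {q T c : ℝ} (hqT : q ≤ T) (h0 : 0 ≤ T) (hTc : T ≤ c)
    (hg : IntervalIntegrable g volume 0 c) (hz : ∀ t ∈ Icc q c, g t = 0) :
    ∫ t in (0 : ℝ)..c, g t = ∫ t in (0 : ℝ)..T, g t := by
  have hsub : ∀ {a b : ℝ}, a ∈ Icc 0 c → b ∈ Icc 0 c → IntervalIntegrable g volume a b :=
    fun ha hb => by
      rw [← uIcc_of_le (h0.trans hTc)] at ha hb
      exact hg.mono_set (uIcc_subset_uIcc ha hb)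
  have hT : T ∈ Icc 0 c := ⟨h0, hTc⟩
  have hc : c ∈ Icc 0 c := ⟨h0.trans hTc, le_rfl⟩
  have h00 : (0 : ℝ) ∈ Icc 0 c := ⟨le_rfl, h0.trans hTc⟩
  rw [← intervalIntegral.integral_add_adjacent_intervals (hsub h00 hT) (hsub hT hc)]
  have : ∫ t in T..c, g t = 0 :=
    (intervalIntegral.integral_congr fun t ht => by
      rw [uIcc_of_le hTc] at ht
      exact hz t ⟨hqT.trans ht.1, ht.2⟩).trans intervalIntegral.integral_zero
  rw [this, add_zero]

lemma pairing_zero_right (A : Matrix (Fin m) (Fin m) ℝ) : pairing A 0 = 0 := by simp [pairing]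

lemma pairing_zero_left (A : Matrix (Fin m) (Fin m) ℝ) : pairing 0 A = 0 := by simp [pairing]

lemma pairing_neg_right (A B : Matrix (Fin m) (Fin m) ℝ) : pairing A (-B) = -pairing A B := by
  simp [pairing]

lemma pairing_neg_left (A B : Matrix (Fin m) (Fin m) ℝ) : pairing (-A) B = -pairing A B := by
  simp [pairing]

lemma pairing_smul_left (c : ℝ) (A B : Matrix (Fin m) (Fin m) ℝ) :
    pairing (c • A) B = c * pairing A B := by
  simp [pairing]

section Variation

variable {Q : Matrix (Fin m) (Fin m) ℝ} {x : ℝ → ℝ} {Φ : ℝ → Matrix (Fin m) (Fin m) ℝ} {T : ℝ}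
  {β : ℕ → Fin m → ℝ} {h : Fin m → ℝ} {μ : Measure ℝ}

/-- Stationarity of the functional at a minimizer in the order parameter. -/
theorem IsRegularPair.integral_orderParameter_variation_nonpos (hp : IsRegularPair Q x Φ T)
    (hβ : IsMixture β) (hmin : IsMinimizer β h Q x μ Φ) {k : ℝ → ℝ}
    (hk : IntervalIntegrable k volume 0 m)
    (hkr : ∀ t ∈ Ico 0 (m : ℝ), ContinuousWithinAt k (Ici t) t)
    {q : ℝ} (hq : q ≤ topPoint m x) (hk0 : ∀ t ∈ Icc q (m : ℝ), k t = 0)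
    (hord : ∀ ε ∈ Icc (0 : ℝ) 1, IsOrderParameter m fun t => x t - ε * k t) :
    ∫ t in (0 : ℝ)..T, k t * pairing (gradient β x Φ t + Matrix.vecMulVec h h) (pathDeriv Φ t)
      ≤ 0 := by
  have hT := hp.cutoff_mem
  have hTI := Ioo_subset_Icc_self hT
  have hqT : q ≤ T := hq.trans hp.cutoff.1.le
  have hm0 : (0 : ℝ) ≤ m := by positivity
  have h0I : (0 : ℝ) ∈ Icc 0 (m : ℝ) := ⟨le_rfl, hm0⟩
  have hmI : (m : ℝ) ∈ Icc 0 (m : ℝ) := ⟨hm0, le_rfl⟩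
  have hx := hp.orderParameter.intervalIntegrable
  set a : ℝ → ℝ := fun t => pairing (xiDeriv β (Φ t) + Matrix.vecMulVec h h) (pathDeriv Φ t)
    with ha
  set P := tailIntegral k (pathDeriv Φ) with hP
  have hac : ContinuousOn a (Icc 0 (m : ℝ)) :=
    ContinuousOn.pairing ((hp.continuousOn_xiDeriv hβ).add continuousOn_const)
      hp.continuousOn_deriv
  have hPc : ContinuousOn P (Icc 0 (m : ℝ)) := continuousOn_tailIntegral hk hp.continuousOn_deriv
  have hxa := intervalIntegrable_mul hm0 hx hac h0I hmI
  have hka := intervalIntegrable_mul hm0 hk hac h0I hmI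
  have hhat : ∀ ε : ℝ, ∀ t ∈ Icc 0 (m : ℝ), hatPath (fun t => x t - ε * k t) Φ t
      = hatPath x Φ t + ε • -P t := by
    intro ε t ht
    ext i j
    have h1 := intervalIntegrable_mul hm0 hx (continuousOn_entry hp.continuousOn_deriv i j) ht hmI
    have h2 := intervalIntegrable_mul hm0 hk (continuousOn_entry hp.continuousOn_deriv i j) ht hmI
    simp only [hatPath, hP, tailIntegral, Matrix.of_apply, Matrix.add_apply, Matrix.smul_apply,
      Matrix.neg_apply, smul_eq_mul]
    rw [mul_neg, ← sub_eq_add_neg, ← intervalIntegral.integral_const_mul,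
      ← intervalIntegral.integral_sub h1 (h2.const_mul ε)]
    exact intervalIntegral.integral_congr fun s _ => by ring
  set E₁ : ℝ → ℝ := fun ε =>
    ∫ t in (0 : ℝ)..T, pairing (hatPath x Φ t + ε • -P t)⁻¹ (pathDeriv Φ t + ε • 0) with hE₁
  have hval : ∀ ε : ℝ, crisantiSommers β h T (fun t => x t - ε * k t) Φ
      = (1 / 2) * (((∫ t in (0 : ℝ)..m, x t * a t) - ε * ∫ t in (0 : ℝ)..m, k t * a t)
        + Real.log (Φ m - Φ T).det + E₁ ε) := by
    intro ε
    rw [crisantiSommers, hE₁]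
    congr 2
    · congr 1
      rw [← intervalIntegral.integral_const_mul,
        ← intervalIntegral.integral_sub hxa (hka.const_mul ε)]
      exact intervalIntegral.integral_congr fun s _ => by simp only [ha]; ring
    · refine intervalIntegral.integral_congr fun t ht => ?_
      rw [uIcc_of_le hT.1.le] at ht
      simp only [hhat ε t (hp.Icc_subset ht), smul_zero, add_zero]
  have hder₁ := hasDerivAt_integral_pairing_inv (U := hatPath x Φ) (V := fun t => -P t)
    (W := pathDeriv Φ) (Y := fun _ => 0) hT.1.le (hp.continuousOn_hatPath.mono hp.Icc_subset)
    (hPc.neg.mono hp.Icc_subset) (hp.continuousOn_deriv.mono hp.Icc_subset) continuousOn_const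
    fun t ht => hp.det_hatPath_ne_zero ht
  have hder : HasDerivAt (fun ε => crisantiSommers β h T (fun t => x t - ε * k t) Φ)
      ((1 / 2) * (-(∫ t in (0 : ℝ)..m, k t * a t)
        + ∫ t in (0 : ℝ)..T, pairing (sandwich x Φ t) (P t))) 0 := by
    simp only [hval]
    have h1 : HasDerivAt (fun ε : ℝ => (∫ t in (0 : ℝ)..m, x t * a t)
        - ε * ∫ t in (0 : ℝ)..m, k t * a t) (-(∫ t in (0 : ℝ)..m, k t * a t)) 0 := by
      simpa using ((hasDerivAt_id (0 : ℝ)).mul_const (∫ t in (0 : ℝ)..m, k t * a t)).const_sub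
        (∫ t in (0 : ℝ)..m, x t * a t)
    refine (((h1.add_const _).add hder₁).const_mul (1 / 2)).congr_deriv ?_
    congr 2
    refine intervalIntegral.integral_congr fun t _ => ?_
    simp only [pairing_zero_right, zero_sub, Matrix.mul_neg, Matrix.neg_mul, pairing_neg_left,
      neg_neg, sandwich]
    exact pairing_sandwich_swap _ _ _
  -- As `k` vanishes from `q ≤ topPoint m x` on, the perturbed order parameter still equals `1` at
  -- the old top point, and `T` remains an admissible cut-off.
  have hnonneg := nonneg_of_hasDerivAt_of_le hder fun ε hε => by
    have hop := hord ε hε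
    have htop := topPoint_mem hp.orderParameter
    have htop' := topPoint_mem hop
    have hle : topPoint m (fun t => x t - ε * k t) ≤ topPoint m x := by
      refine topPoint_le htop ?_
      simp only [hk0 _ ⟨hq, htop.2⟩, mul_zero, sub_zero, apply_topPoint hp.orderParameter]
    simp only [zero_mul, sub_zero]
    exact hmin.le_of_differentiable hp.one_le hp.constraint hop hp.path hp.differentiable hp.cutoff
      ⟨hle.trans_lt hp.cutoff.1, hp.cutoff.2⟩
      ((monotoneOn_trace hp.path htop' htop hle).trans_lt hp.trace_lt)
  have hPT : P T = 0 := tailIntegral_eq_zero hqT hT.2.le fun s hs => by rw [hk0 s hs, zero_smul]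
  have hkT : IntervalIntegrable k volume 0 T := hk.mono_set (by
    rw [uIcc_of_le hm0, uIcc_of_le hT.1.le]; exact hp.Icc_subset)
  have h0T : (0 : ℝ) ∈ Icc 0 T := ⟨le_rfl, hT.1.le⟩
  have hTT : T ∈ Icc 0 T := ⟨hT.1.le, le_rfl⟩
  have hc₁ : ContinuousOn (fun t => pairing (sandwich x Φ t) (P t)) (Icc 0 T) :=
    ContinuousOn.pairing hp.continuousOn_sandwich (hPc.mono hp.Icc_subset)
  have hi₁ : IntervalIntegrable (fun t => pairing (sandwich x Φ t) (P t)) volume 0 T :=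
    hc₁.intervalIntegrable_of_Icc hT.1.le
  have hi₂ : IntervalIntegrable
      (fun t => k t * pairing (sandwichIntegral x Φ t) (pathDeriv Φ t)) volume 0 T :=
    intervalIntegrable_mul hT.1.le hkT (ContinuousOn.pairing hp.continuousOn_sandwichIntegral
      (hp.continuousOn_deriv.mono hp.Icc_subset)) h0T hTT
  -- Integration by parts for `⟨S, P⟩`, where `S` is `sandwichIntegral`: `S` vanishes at `0` and `P`
  -- at `T`. It trades the nonlocal `P` for the local factor `k`.
  have hftc : ∫ t in (0 : ℝ)..T, (pairing (sandwich x Φ t) (P t)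
      - k t * pairing (sandwichIntegral x Φ t) (pathDeriv Φ t)) = 0 := by
    rw [intervalIntegral.integral_eq_sub_of_hasDeriv_right_of_le hT.1.le
      (f := fun t => pairing (sandwichIntegral x Φ t) (P t))
      (ContinuousOn.pairing hp.continuousOn_sandwichIntegral (hPc.mono hp.Icc_subset)) _
      (hi₁.sub hi₂)]
    · simp only [hPT, sandwichIntegral_zero, pairing_zero_left, pairing_zero_right, sub_zero]
    · intro t ht
      have htI : t ∈ Ico 0 (m : ℝ) := ⟨ht.1.le, ht.2.trans hT.2⟩
      have h1 : HasEntryDerivWithinAt (sandwichIntegral x Φ) (sandwich x Φ t) (Ioi t) t :=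
        fun i j => ((hp.hasEntryDerivWithinAt_sandwichIntegral (Ioo_subset_Icc_self ht) i
          j).hasDerivAt (Icc_mem_nhds ht.1 ht.2)).hasDerivWithinAt
      have h2 := hasEntryDerivWithinAt_tailIntegral hk hp.continuousOn_deriv htI (hkr t htI)
      refine (h1.pairing h2).congr_deriv ?_
      rw [pairing_neg_right, pairing_smul_right, sub_eq_add_neg]
  rw [intervalIntegral.integral_sub hi₁ hi₂] at hftc
  rw [integral_eq_integral_of_eq_zero hqT hT.1.le hT.2.le hka
    fun t ht => by rw [hk0 t ht, zero_mul]] at hnonneg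
  have hkaT : IntervalIntegrable (fun t => k t * a t) volume 0 T :=
    intervalIntegrable_mul hm0 hk hac h0I hTI
  have hsplit : ∫ t in (0 : ℝ)..T,
      k t * pairing (gradient β x Φ t + Matrix.vecMulVec h h) (pathDeriv Φ t)
      = (∫ t in (0 : ℝ)..T, k t * a t)
        - ∫ t in (0 : ℝ)..T, k t * pairing (sandwichIntegral x Φ t) (pathDeriv Φ t) := by
    rw [← intervalIntegral.integral_sub hkaT hi₂]
    refine intervalIntegral.integral_congr fun t _ => ?_
    simp only [ha, gradient, pairing_add_left, pairing_sub_left]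
    ring
  rw [hsplit]
  linarith

/-- Stationarity of the functional at a minimizer in the path. -/
theorem IsRegularPair.integral_path_variation_nonneg (hp : IsRegularPair Q x Φ T)
    (hβ : IsMixture β) (hmin : IsMinimizer β h Q x μ Φ)
    {Ψ Ψ' : ℝ → Matrix (Fin m) (Fin m) ℝ}
    (hΨ : ∀ t ∈ Icc 0 (m : ℝ), HasEntryDerivWithinAt Ψ (Ψ' t) (Icc 0 (m : ℝ)) t)
    (hΨ' : ContinuousOn Ψ' (Icc 0 (m : ℝ))) (hΨ0 : Ψ 0 = 0)
    {q : ℝ} (hq : q ≤ topPoint m x) (hΨq : ∀ t ∈ Icc q (m : ℝ), Ψ t = 0)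
    (hΨ'q : ∀ t ∈ Icc q (m : ℝ), Ψ' t = 0)
    (hsymm : ∀ t ∈ Icc 0 (m : ℝ), ∀ i j, Ψ t j i = Ψ t i j)
    (hmono : ∀ ε ∈ Icc (0 : ℝ) 1, IsMonotonePath Q fun t => Φ t + ε • Ψ t) :
    0 ≤ ∫ t in (0 : ℝ)..T, x t * (pairing (gradientDeriv β x Φ t) (Ψ t)
      + pairing (gradient β x Φ t + Matrix.vecMulVec h h) (Ψ' t)) := by
  have hT := hp.cutoff_mem
  have hTI := Ioo_subset_Icc_self hT
  have hqT : q ≤ T := hq.trans hp.cutoff.1.le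
  have hm0 : (0 : ℝ) ≤ m := by positivity
  have h0I : (0 : ℝ) ∈ Icc 0 (m : ℝ) := ⟨le_rfl, hm0⟩
  have hmI : (m : ℝ) ∈ Icc 0 (m : ℝ) := ⟨hm0, le_rfl⟩
  have htop := topPoint_mem hp.orderParameter
  have hx := hp.orderParameter.intervalIntegrable
  have hΨc : ContinuousOn Ψ (Icc 0 (m : ℝ)) := fun t ht => (hΨ t ht).continuousWithinAt
  set P := tailIntegral x Ψ' with hP
  have hPc : ContinuousOn P (Icc 0 (m : ℝ)) := continuousOn_tailIntegral hx hΨ'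
  have hentry : ∀ ε : ℝ, ∀ t ∈ Icc 0 (m : ℝ), HasEntryDerivWithinAt (fun t => Φ t + ε • Ψ t)
      (pathDeriv Φ t + ε • Ψ' t) (Icc 0 (m : ℝ)) t := fun ε t ht i j =>
    (hp.hasEntryDerivWithinAt_path ht i j).add ((hΨ t ht i j).const_mul ε)
  have hpd : ∀ ε : ℝ, ∀ t ∈ Icc 0 (m : ℝ), pathDeriv (fun t => Φ t + ε • Ψ t) t
      = pathDeriv Φ t + ε • Ψ' t := fun ε t ht =>
    pathDeriv_eq_of_hasDerivWithinAt hp.one_le ht (hentry ε t ht)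
  have hhat : ∀ ε : ℝ, ∀ t ∈ Icc 0 (m : ℝ), hatPath x (fun t => Φ t + ε • Ψ t) t
      = hatPath x Φ t + ε • P t := by
    intro ε t ht
    ext i j
    have h1 := intervalIntegrable_mul hm0 hx (continuousOn_entry hp.continuousOn_deriv i j) ht hmI
    have h2 := intervalIntegrable_mul hm0 hx (continuousOn_entry hΨ' i j) ht hmI
    simp only [hatPath, hP, tailIntegral, Matrix.of_apply, Matrix.add_apply, Matrix.smul_apply,
      smul_eq_mul]
    rw [← intervalIntegral.integral_const_mul,
      ← intervalIntegral.integral_add h1 (h2.const_mul ε)]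
    refine intervalIntegral.integral_congr fun s hs => ?_
    rw [uIcc_of_le ht.2] at hs
    simp only [hpd ε s ⟨ht.1.trans hs.1, hs.2⟩, Matrix.add_apply, Matrix.smul_apply, smul_eq_mul]
    ring
  set E₁ : ℝ → ℝ := fun ε => ∫ t in (0 : ℝ)..m,
    x t * pairing (xiDeriv β (Φ t + ε • Ψ t) + Matrix.vecMulVec h h)
      (pathDeriv Φ t + ε • Ψ' t) with hE₁
  set E₂ : ℝ → ℝ := fun ε =>
    ∫ t in (0 : ℝ)..T, pairing (hatPath x Φ t + ε • P t)⁻¹ (pathDeriv Φ t + ε • Ψ' t) with hE₂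
  -- The perturbation is zero from `q` on, so the logarithm and the cut-off conditions do not
  -- change.
  have hΨT : Ψ T = 0 := hΨq T ⟨hqT, hT.2.le⟩
  have hΨm : Ψ m = 0 := hΨq m ⟨hq.trans htop.2, le_rfl⟩
  have hval : ∀ ε : ℝ, crisantiSommers β h T x (fun t => Φ t + ε • Ψ t)
      = (1 / 2) * (E₁ ε + Real.log (Φ m - Φ T).det + E₂ ε) := by
    intro ε
    rw [crisantiSommers, hE₁, hE₂]
    simp only [hΨT, hΨm, smul_zero, add_zero]
    congr 2
    · congr 1
      refine intervalIntegral.integral_congr fun t ht => ?_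
      rw [uIcc_of_le hm0] at ht
      simp only [hpd ε t ht]
    · refine intervalIntegral.integral_congr fun t ht => ?_
      rw [uIcc_of_le hT.1.le] at ht
      simp only [hhat ε t (hp.Icc_subset ht), hpd ε t (hp.Icc_subset ht)]
  have hder₁ := hasDerivAt_integral_pairing_xiDeriv hβ (Matrix.vecMulVec h h) hm0 hx
    (continuousOn_path hp.differentiable) hΨc hp.continuousOn_deriv hΨ'
    fun t ht => hp.abs_apply_le_one ht
  have hder₂ := hasDerivAt_integral_pairing_inv hT.1.le
    (hp.continuousOn_hatPath.mono hp.Icc_subset)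
    (hPc.mono hp.Icc_subset) (hp.continuousOn_deriv.mono hp.Icc_subset)
    (hΨ'.mono hp.Icc_subset) fun t ht => hp.det_hatPath_ne_zero ht
  have hder : HasDerivAt (fun ε : ℝ => crisantiSommers β h T x (fun t => Φ t + ε • Ψ t))
      ((1 / 2) * ((∫ t in (0 : ℝ)..m, x t * (pairing (xiDeriv2 β (Φ t) ⊙ Ψ t) (pathDeriv Φ t)
          + pairing (xiDeriv β (Φ t) + Matrix.vecMulVec h h) (Ψ' t)))
        + ∫ t in (0 : ℝ)..T, (pairing (hatPath x Φ t)⁻¹ (Ψ' t)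
          - pairing ((hatPath x Φ t)⁻¹ * P t * (hatPath x Φ t)⁻¹) (pathDeriv Φ t)))) 0 := by
    simp only [hval]
    exact ((hder₁.add_const _).add hder₂).const_mul (1 / 2)
  have hnonneg := nonneg_of_hasDerivAt_of_le hder fun ε hε => by
    simp only [zero_smul, add_zero]
    refine hmin.le_of_differentiable hp.one_le hp.constraint hp.orderParameter (hmono ε hε)
      (fun i j t ht => (hentry ε t ht i j).differentiableWithinAt) hp.cutoff ?_ ?_
    · refine ⟨hp.cutoff.1, hp.cutoff.2.1, ?_⟩
      simpa only [hΨT, smul_zero, add_zero] using hp.cutoff.2.2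
    · simpa only [hΨT, hΨq _ ⟨hq, htop.2⟩, smul_zero, add_zero] using hp.trace_lt
  have hPT : P T = 0 := tailIntegral_eq_zero hqT hT.2.le fun s hs => by rw [hΨ'q s hs, smul_zero]
  have hxT : IntervalIntegrable x volume 0 T := hx.mono_set (by
    rw [uIcc_of_le hm0, uIcc_of_le hT.1.le]; exact hp.Icc_subset)
  have h0T : (0 : ℝ) ∈ Icc 0 T := ⟨le_rfl, hT.1.le⟩
  have hTT : T ∈ Icc 0 T := ⟨hT.1.le, le_rfl⟩
  have hsub := hp.Icc_subset
  have hΨ'T := hΨ'.mono hsub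
  have hΨT' := hΨc.mono hsub
  have hi₁ : IntervalIntegrable (fun t => pairing (hatPath x Φ t)⁻¹ (Ψ' t)
      - pairing ((hatPath x Φ t)⁻¹ * P t * (hatPath x Φ t)⁻¹) (pathDeriv Φ t)) volume 0 T :=
    ((ContinuousOn.pairing hp.continuousOn_inv_hatPath hΨ'T).sub
      (ContinuousOn.pairing ((hp.continuousOn_inv_hatPath.mul (hPc.mono hsub)).mul
        hp.continuousOn_inv_hatPath) (hp.continuousOn_deriv.mono hsub))).intervalIntegrable_of_Icc
      hT.1.le
  have hi₂ : IntervalIntegrable (fun t => x t * (pairing (sandwich x Φ t) (Ψ t)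
      + pairing (sandwichIntegral x Φ t) (Ψ' t))) volume 0 T :=
    intervalIntegrable_mul hT.1.le hxT ((ContinuousOn.pairing hp.continuousOn_sandwich hΨT').add
      (ContinuousOn.pairing hp.continuousOn_sandwichIntegral hΨ'T)) h0T hTT
  -- The integrand is the right derivative of `⟨Φ̂⁻¹, Ψ⟩ - ⟨S, P⟩` with `S` the `sandwichIntegral`,
  -- which vanishes at both ends. Differentiating `Φ̂⁻¹` produces the factor `x`, and the terms
  -- containing `P` cancel.
  have hftc : ∫ t in (0 : ℝ)..T, ((pairing (hatPath x Φ t)⁻¹ (Ψ' t)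
      - pairing ((hatPath x Φ t)⁻¹ * P t * (hatPath x Φ t)⁻¹) (pathDeriv Φ t))
      + x t * (pairing (sandwich x Φ t) (Ψ t)
      + pairing (sandwichIntegral x Φ t) (Ψ' t))) = 0 := by
    rw [intervalIntegral.integral_eq_sub_of_hasDeriv_right_of_le hT.1.le
      (f := fun t => pairing (hatPath x Φ t)⁻¹ (Ψ t) - pairing (sandwichIntegral x Φ t) (P t))
      ((ContinuousOn.pairing hp.continuousOn_inv_hatPath hΨT').sub
        (ContinuousOn.pairing hp.continuousOn_sandwichIntegral (hPc.mono hsub))) _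
      (hi₁.add hi₂)]
    · simp only [hPT, hΨT, hΨ0, sandwichIntegral_zero, pairing_zero_left, pairing_zero_right,
        sub_zero]
    · intro t ht
      have htI : t ∈ Ico 0 (m : ℝ) := ⟨ht.1.le, ht.2.trans hT.2⟩
      have h1 : HasEntryDerivWithinAt (sandwichIntegral x Φ) (sandwich x Φ t) (Ioi t) t :=
        fun i j => ((hp.hasEntryDerivWithinAt_sandwichIntegral (Ioo_subset_Icc_self ht) i
          j).hasDerivAt (Icc_mem_nhds ht.1 ht.2)).hasDerivWithinAt
      have h2 := hasEntryDerivWithinAt_tailIntegral hx hΨ' htI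
        (hp.orderParameter.rightContinuous t htI)
      have h3 := (hp.hasEntryDerivWithinAt_hatPath htI).inv
        (hp.det_hatPath_ne_zero (Ioo_subset_Icc_self ht))
      have h4 : HasEntryDerivWithinAt Ψ (Ψ' t) (Ioi t) t :=
        fun i j => ((hΨ t ⟨htI.1, htI.2.le⟩ i j).hasDerivAt
          (Icc_mem_nhds ht.1 htI.2)).hasDerivWithinAt
      refine ((h3.pairing h4).sub (h1.pairing h2)).congr_deriv ?_
      simp only [Matrix.mul_neg, Matrix.neg_mul, neg_neg, Matrix.mul_smul, Matrix.smul_mul,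
        pairing_smul_left, pairing_neg_right, pairing_smul_right]
      rw [pairing_sandwich_swap _ (P t)]
      simp only [sandwich, hP]
      ring
  rw [intervalIntegral.integral_add hi₁ hi₂] at hftc
  set b : ℝ → ℝ := fun t => pairing (xiDeriv2 β (Φ t) ⊙ Ψ t) (pathDeriv Φ t)
    + pairing (xiDeriv β (Φ t) + Matrix.vecMulVec h h) (Ψ' t) with hb
  have hbc : ContinuousOn b (Icc 0 (m : ℝ)) :=
    (ContinuousOn.pairing (hp.continuousOn_xiDeriv2_hadamard hβ hΨc) hp.continuousOn_deriv).add
      (ContinuousOn.pairing ((hp.continuousOn_xiDeriv hβ).add continuousOn_const) hΨ')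
  have hxb := intervalIntegrable_mul hm0 hx hbc h0I hmI
  have hxbT := intervalIntegrable_mul hm0 hx hbc h0I hTI
  have hb0 : ∀ t ∈ Icc q (m : ℝ), x t * b t = 0 := fun t ht => by
    simp [hb, hΨq t ht, hΨ'q t ht, pairing_zero_right, pairing_zero_left]
  rw [integral_eq_integral_of_eq_zero hqT hT.1.le hT.2.le hxb hb0] at hnonneg
  have hsplit : ∫ t in (0 : ℝ)..T, x t * (pairing (gradientDeriv β x Φ t) (Ψ t)
      + pairing (gradient β x Φ t + Matrix.vecMulVec h h) (Ψ' t))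
      = (∫ t in (0 : ℝ)..T, x t * b t) - ∫ t in (0 : ℝ)..T, x t * (pairing (sandwich x Φ t) (Ψ t)
      + pairing (sandwichIntegral x Φ t) (Ψ' t)) := by
    rw [← intervalIntegral.integral_sub hxbT hi₂]
    refine intervalIntegral.integral_congr fun t ht => ?_
    rw [uIcc_of_le hT.1.le] at ht
    -- Both `Ψ` and `Φ'` are symmetric, so the entrywise factor can be moved from one to the other.
    have hsw : pairing (xiDeriv2 β (Φ t) ⊙ Ψ t) (pathDeriv Φ t)
        = pairing (xiDeriv2 β (Φ t) ⊙ pathDeriv Φ t) (Ψ t) := by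
      simp only [pairing_eq_sum, Matrix.hadamard_apply]
      refine Finset.sum_congr rfl fun i _ => Finset.sum_congr rfl fun j _ => ?_
      have : pathDeriv Φ t j i = pathDeriv Φ t i j := by
        simpa using (posSemidef_pathDeriv hp.one_le hp.path hp.differentiable (hsub ht)).1.apply i j
      rw [this, hsymm t (hsub ht) i j]
      ring
    simp only [hb, gradient, gradientDeriv, pairing_add_left, pairing_sub_left, hsw]
    ring
  rw [hsplit]
  linarith

end Variation

/-! ### Integration against the distribution -/

/-- Fubini on `{s ≤ t}`, because `x t = μ [0,t]`; the boundary term disappears with `p T = 0`. The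
closed interval on the right includes a possible atom at `0`. -/
lemma integral_distribution_mul_deriv {x : ℝ → ℝ} {μ : Measure ℝ} (hx : IsOrderParameter m x)
    (hμ : HasDistribution m x μ) {T : ℝ} (hT : T ∈ Icc 0 (m : ℝ)) {p p' : ℝ → ℝ}
    (hp : ∀ t ∈ Icc 0 T, HasDerivWithinAt p (p' t) (Icc 0 T) t)
    (hp' : ContinuousOn p' (Icc 0 T)) (hpT : p T = 0) :
    ∫ t in (0 : ℝ)..T, x t * p' t = -∫ s in Icc 0 T, p s ∂μ := by
  have hfin : μ (Icc 0 T) < ⊤ := by rw [hμ.measure_Icc T hT]; exact ENNReal.ofReal_lt_top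
  have : IsFiniteMeasure (μ.restrict (Icc 0 T)) := ⟨by simpa using hfin⟩
  set g : ℝ → ℝ → ℝ := fun t s => indicator {z : ℝ × ℝ | z.2 ≤ z.1} (fun z => p' z.1) (t, s)
    with hg
  have hint : Integrable (Function.uncurry g)
      ((volume.restrict (Icc 0 T)).prod (μ.restrict (Icc 0 T))) :=
    ((hp'.integrableOn_Icc).comp_fst _).indicator (measurableSet_le measurable_snd measurable_fst)
  have hleft : ∫ t in (0 : ℝ)..T, x t * p' t
      = ∫ t in Icc 0 T, ∫ s in Icc 0 T, g t s ∂μ := by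
    rw [intervalIntegral.integral_of_le hT.1, ← integral_Icc_eq_integral_Ioc]
    refine setIntegral_congr_fun measurableSet_Icc fun t ht => ?_
    have e : g t = indicator (Iic t) fun _ => p' t := by
      ext s; simp [hg, indicator]
    simp only [e]
    rw [integral_indicator_const _ measurableSet_Iic, measureReal_restrict_apply measurableSet_Iic,
      show Iic t ∩ Icc 0 T = Icc 0 t by ext s; simp only [mem_inter_iff, mem_Iic, mem_Icc]; grind,
      measureReal_def, hμ.measure_Icc t ⟨ht.1, ht.2.trans hT.2⟩,
      ENNReal.toReal_ofReal (hx.nonneg t ⟨ht.1, ht.2.trans hT.2⟩), smul_eq_mul]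
  rw [hleft, integral_integral_swap hint, ← integral_neg]
  refine setIntegral_congr_fun measurableSet_Icc fun s hs => ?_
  have e : (fun t => g t s) = indicator (Ici s) p' := by
    ext t; simp [hg, indicator]
  simp only [e]
  rw [setIntegral_indicator measurableSet_Ici,
    show Icc 0 T ∩ Ici s = Icc s T by ext t; simp only [mem_inter_iff, mem_Ici, mem_Icc]; grind,
    integral_Icc_eq_integral_Ioc, ← intervalIntegral.integral_of_le hs.2,
    intervalIntegral.integral_eq_sub_of_hasDerivAt_of_le hs.2 (f := p), hpT, zero_sub]
  · exact fun t ht => ((hp t ⟨hs.1.trans ht.1, ht.2⟩).continuousWithinAt).mono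
      (Icc_subset_Icc_left hs.1)
  · exact fun t ht => (hp t ⟨hs.1.trans ht.1.le, ht.2.le⟩).hasDerivAt
      (Icc_mem_nhds (hs.1.trans_lt ht.1) ht.2)
  · exact (hp'.mono (Icc_subset_Icc_left hs.1)).intervalIntegrable_of_Icc hs.2

/-! ### The two variations used at the origin -/

/-- For `ε ≤ 1` the map `u ↦ u - ε * min u κ` is nondecreasing and nonnegative on `u ≥ 0`. Stopping
the subtraction at `q` only adds an upward jump. -/
lemma isOrderParameter_sub_min {x : ℝ → ℝ} (hx : IsOrderParameter m x) {κ q : ℝ} (hκ : 0 ≤ κ)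
    (hqm : q ≤ m) {k : ℝ → ℝ} (hk : k = fun t => if t < q then min (x t) κ else 0)
    (hkr : ∀ t ∈ Ico 0 (m : ℝ), ContinuousWithinAt k (Ici t) t) {ε : ℝ} (hε : ε ∈ Icc (0 : ℝ) 1) :
    IsOrderParameter m fun t => x t - ε * k t where
  monotoneOn s hs t ht hst := by
    have hxst := hx.monotoneOn hs ht hst
    have h0 := hx.nonneg s hs
    have hmin0 : 0 ≤ min (x s) κ := le_min h0 hκ
    simp only [hk]
    split_ifs with h1 h2 h2
    · rcases le_total (x s) κ with h3 | h3 <;> rcases le_total (x t) κ with h4 | h4 <;>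
        simp only [h3, h4, min_eq_left, min_eq_right] <;>
        nlinarith [hε.1, hε.2]
    · nlinarith [mul_nonneg hε.1 hmin0]
    · exact absurd (hst.trans_lt h2) h1
    · linarith
  rightContinuous t ht := (hx.rightContinuous t ht).sub (continuousWithinAt_const.mul (hkr t ht))
  nonneg t ht := by
    have h0 := hx.nonneg t ht
    simp only [hk]
    split_ifs
    · nlinarith [min_le_left (x t) κ, hε.1, hε.2, le_min h0 hκ]
    · linarith
  right_end := by simp [hk, hqm, hx.right_end]

lemma continuousWithinAt_truncated_min {x : ℝ → ℝ} (hx : IsOrderParameter m x) (κ q : ℝ) {t : ℝ}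
    (ht : t ∈ Ico 0 (m : ℝ)) :
    ContinuousWithinAt (fun t => if t < q then min (x t) κ else 0) (Ici t) t := by
  rcases lt_or_ge t q with h | h
  · refine ((hx.rightContinuous t ht).inf continuousWithinAt_const).congr_of_eventuallyEq
      (f := fun t => min (x t) κ) ?_ (by simp [h])
    filter_upwards [mem_nhdsWithin_of_mem_nhds (Iio_mem_nhds h)] with s hs
    exact if_pos hs
  · refine (continuousWithinAt_const (b := (0 : ℝ))).congr (fun s hs => ?_) (by simp [h])
    exact if_neg (not_lt.2 (h.trans hs))

lemma hasDerivAt_sq_max (r : ℝ) : HasDerivAt (fun r : ℝ => (max r 0) ^ 2) (2 * max r 0) r := by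
  rcases lt_trichotomy r 0 with h | rfl | h
  · rw [max_eq_right h.le, mul_zero]
    refine (hasDerivAt_const r (0 : ℝ)).congr_of_eventuallyEq ?_
    filter_upwards [Iio_mem_nhds h] with s hs
    simp [max_eq_right (le_of_lt (mem_Iio.1 hs))]
  · simp only [max_self, mul_zero]
    refine HasDerivAt.of_isLittleO ?_
    have : (fun r : ℝ => (max r 0) ^ 2) =O[𝓝 0] fun r => r ^ 2 := by
      refine Asymptotics.IsBigO.of_bound 1 (Eventually.of_forall fun s => ?_)
      rw [one_mul, norm_pow, norm_pow]
      gcongr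
      simp only [Real.norm_eq_abs]
      rcases le_total s 0 with hs | hs <;> simp [hs]
    refine (this.trans_isLittleO ?_).congr_left (by simp)
    simpa using (Asymptotics.isLittleO_pow_id (𝕜 := ℝ) one_lt_two)
  · rw [max_eq_left h.le]
    refine HasDerivAt.congr_of_eventuallyEq (f := fun r : ℝ => r ^ 2)
      (by simpa using hasDerivAt_pow 2 r) ?_
    filter_upwards [Ioi_mem_nhds h] with s hs
    simp [max_eq_left (le_of_lt (mem_Ioi.1 hs))]

section Origin

variable {Q : Matrix (Fin m) (Fin m) ℝ} {x : ℝ → ℝ} {Φ : ℝ → Matrix (Fin m) (Fin m) ℝ} {T : ℝ}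
  {β : ℕ → Fin m → ℝ} {h : Fin m → ℝ} {μ : Measure ℝ}

lemma IsRegularPair.continuousOn_pairing_gradient (hp : IsRegularPair Q x Φ T) (hβ : IsMixture β)
    {Y : ℝ → Matrix (Fin m) (Fin m) ℝ} (hY : ContinuousOn Y (Icc 0 (m : ℝ))) :
    ContinuousOn (fun t => pairing (gradient β x Φ t + Matrix.vecMulVec h h) (Y t)) (Icc 0 T) :=
  ContinuousOn.pairing ((hp.continuousOn_gradient hβ).add continuousOn_const)
    (hY.mono hp.Icc_subset)

/-- Ideally `x` would be lowered by a constant on `[0,q)`, but `x` may tend to `0` at the origin.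
The capped direction `min (x t) (x δ)` is admissible and equals the constant `x δ` on `[δ,q)`. The
error from `[0,δ]` is at most `x δ * C * δ`; dividing by `x δ > 0` and letting `δ → 0` removes it.
-/
theorem IsRegularPair.integral_pairing_gradient_nonpos (hp : IsRegularPair Q x Φ T)
    (hβ : IsMixture β) (hmin : IsMinimizer β h Q x μ Φ) (hpos : ∀ t ∈ Ioc 0 (m : ℝ), 0 < x t)
    {q : ℝ} (hq0 : 0 < q) (hq : q ≤ topPoint m x) :
    ∫ t in (0 : ℝ)..q, pairing (gradient β x Φ t + Matrix.vecMulVec h h) (pathDeriv Φ t) ≤ 0 := by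
  have hx := hp.orderParameter
  have hT := hp.cutoff_mem
  have hqT : q ≤ T := hq.trans hp.cutoff.1.le
  have hqm : q ≤ m := hqT.trans hT.2.le
  have hm0 : (0 : ℝ) ≤ m := by positivity
  set F : ℝ → ℝ := fun t => pairing (gradient β x Φ t + Matrix.vecMulVec h h) (pathDeriv Φ t)
  have hF : ContinuousOn F (Icc 0 T) := hp.continuousOn_pairing_gradient hβ hp.continuousOn_deriv
  obtain ⟨C, hC⟩ := isCompact_Icc.exists_bound_of_continuousOn hF
  have hFq : IntervalIntegrable F volume 0 q :=
    (hF.mono (Icc_subset_Icc_right hqT)).intervalIntegrable_of_Icc hq0.le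
  have key : ∀ δ ∈ Ioo 0 q, ∫ t in (0 : ℝ)..q, F t ≤ C * δ := by
    intro δ hδ
    have hδm : δ ∈ Icc 0 (m : ℝ) := ⟨hδ.1.le, hδ.2.le.trans hqm⟩
    have hκ : 0 < x δ := hpos δ ⟨hδ.1, hδm.2⟩
    set k : ℝ → ℝ := fun t => if t < q then min (x t) (x δ) else 0 with hk
    have hkr : ∀ t ∈ Ico 0 (m : ℝ), ContinuousWithinAt k (Ici t) t := fun t ht =>
      continuousWithinAt_truncated_min hx _ _ ht
    have hmi : IntervalIntegrable (fun t => min (x t) (x δ)) volume 0 m := by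
      refine MonotoneOn.intervalIntegrable ?_
      rw [uIcc_of_le hm0]
      exact fun s hs t ht hst => min_le_min_right _ (hx.monotoneOn hs ht hst)
    have hki : IntervalIntegrable k volume 0 m := by
      have : k = indicator (Iio q) fun t => min (x t) (x δ) := by
        ext t; simp [hk, indicator]
      rw [this, intervalIntegrable_iff]
      exact (intervalIntegrable_iff.1 hmi).indicator measurableSet_Iio
    have hk0 : ∀ t ∈ Icc q (m : ℝ), k t = 0 := fun t ht => if_neg (not_lt.2 ht.1)
    have hvar := hp.integral_orderParameter_variation_nonpos hβ hmin hki hkr hq hk0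
      fun ε hε => isOrderParameter_sub_min hx hκ.le hqm hk hkr hε
    have hkT : IntervalIntegrable k volume 0 T := hki.mono_set (by
      rw [uIcc_of_le hm0, uIcc_of_le hT.1.le]; exact hp.Icc_subset)
    have h0T : (0 : ℝ) ∈ Icc 0 T := ⟨le_rfl, hT.1.le⟩
    have hkF := intervalIntegrable_mul hT.1.le hkT hF h0T ⟨hT.1.le, le_rfl⟩
    have hkFq := intervalIntegrable_mul hT.1.le hkT hF h0T ⟨hq0.le, hqT⟩
    rw [integral_eq_integral_of_eq_zero le_rfl hq0.le hqT hkF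
      fun t ht => by rw [hk0 t ⟨ht.1, ht.2.trans hT.2.le⟩, zero_mul]] at hvar
    have hdiff : IntervalIntegrable (fun t => (x δ - k t) * F t) volume 0 q := by
      refine ((hFq.const_mul (x δ)).sub hkFq).congr ?_
      exact fun t _ => by ring
    have hsum : x δ * ∫ t in (0 : ℝ)..q, F t
        = (∫ t in (0 : ℝ)..q, k t * F t) + ∫ t in (0 : ℝ)..q, (x δ - k t) * F t := by
      rw [← intervalIntegral.integral_const_mul, ← intervalIntegral.integral_add hkFq hdiff]
      exact intervalIntegral.integral_congr fun t _ => by ring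
    have hsub : ∀ {a b : ℝ}, a ∈ Icc 0 q → b ∈ Icc 0 q →
        IntervalIntegrable (fun t => (x δ - k t) * F t) volume a b := fun ha hb => by
      rw [← uIcc_of_le hq0.le] at ha hb
      exact hdiff.mono_set (uIcc_subset_uIcc ha hb)
    -- On `[δ,q)` monotonicity gives `k = x δ`, so the defect lives on `[0,δ]`.
    have hsplit : ∫ t in (0 : ℝ)..q, (x δ - k t) * F t
        = ∫ t in (0 : ℝ)..δ, (x δ - k t) * F t := by
      rw [← intervalIntegral.integral_add_adjacent_intervals
        (hsub ⟨le_rfl, hq0.le⟩ ⟨hδ.1.le, hδ.2.le⟩) (hsub ⟨hδ.1.le, hδ.2.le⟩ ⟨hq0.le, le_rfl⟩)]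
      have : ∫ t in δ..q, (x δ - k t) * F t = 0 := by
        rw [intervalIntegral.integral_of_le hδ.2.le, integral_Ioc_eq_integral_Ioo]
        refine (setIntegral_congr_fun measurableSet_Ioo fun t ht => ?_).trans
          (integral_zero _ _)
        have h1 : x δ ≤ x t := hx.monotoneOn hδm ⟨hδ.1.le.trans ht.1.le, ht.2.le.trans hqm⟩ ht.1.le
        simp [hk, ht.2, h1]
      rw [this, add_zero]
    have hbound : ∫ t in (0 : ℝ)..δ, (x δ - k t) * F t ≤ x δ * C * δ := by
      have := intervalIntegral.norm_integral_le_of_norm_le_const (a := 0) (b := δ)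
        (f := fun t => (x δ - k t) * F t) (C := x δ * C) fun t ht => by
          rw [uIoc_of_le hδ.1.le] at ht
          have htm : t ∈ Icc 0 (m : ℝ) := ⟨ht.1.le, ht.2.trans hδm.2⟩
          have h0 : 0 ≤ k t := by
            simp only [hk]; split_ifs
            exacts [le_min (hx.nonneg t htm) hκ.le, le_rfl]
          have h1 : k t ≤ x δ := by
            simp only [hk]; split_ifs
            exacts [min_le_right _ _, hκ.le]
          rw [norm_mul]
          refine mul_le_mul ?_ (hC t ⟨ht.1.le, ht.2.trans (hδ.2.le.trans hqT)⟩) (norm_nonneg _)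
            hκ.le
          rw [Real.norm_eq_abs, abs_of_nonneg (by linarith)]
          linarith
      rw [sub_zero, abs_of_pos hδ.1] at this
      exact (le_abs_self _).trans this
    have hfinal : x δ * ∫ t in (0 : ℝ)..q, F t ≤ x δ * (C * δ) := by
      rw [hsum, hsplit]
      linarith
    exact le_of_mul_le_mul_left hfinal hκ
  have hlim : Tendsto (fun δ : ℝ => C * δ) (𝓝[>] 0) (𝓝 0) := by
    have : Tendsto (fun δ : ℝ => C * δ) (𝓝 0) (𝓝 (C * 0)) := (continuous_const_mul C).tendsto 0
    rw [mul_zero] at this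
    exact this.mono_left nhdsWithin_le_nhds
  refine ge_of_tendsto hlim ?_
  filter_upwards [Ioo_mem_nhdsGT hq0] with δ hδ
  exact key δ hδ

/-- The factor `1 - ε η` is nonnegative and nondecreasing, and it multiplies a nonnegative
nondecreasing path. -/
lemma isMonotonePath_smul (hΦ : IsMonotonePath Q Φ) {η : ℝ → ℝ} (hη : AntitoneOn η (Icc 0 (m : ℝ)))
    (hη1 : ∀ t ∈ Icc 0 (m : ℝ), η t ≤ 1) (hηm : η m = 0)
    {ε : ℝ} (hε : ε ∈ Icc (0 : ℝ) 1) :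
    IsMonotonePath Q fun t => Φ t + ε • -(η t • Φ t) := by
  have e : ∀ t, Φ t + ε • -(η t • Φ t) = (1 - ε * η t) • Φ t := fun t => by
    rw [sub_smul, one_smul, smul_neg, smul_smul, sub_eq_add_neg]
  have hc : ∀ t ∈ Icc 0 (m : ℝ), 0 ≤ 1 - ε * η t := fun t ht => by
    nlinarith [hη1 t ht, hε.1, hε.2]
  simp only [e]
  refine ⟨fun t ht => (hΦ.posSemidef t ht).smul (hc t ht), fun s hs t ht hst => ?_, ?_, ?_⟩
  · have e2 : (1 - ε * η t) • Φ t - (1 - ε * η s) • Φ s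
        = (1 - ε * η t) • (Φ t - Φ s) + (ε * (η s - η t)) • Φ s := by
      rw [smul_sub, mul_sub]
      module
    rw [e2]
    exact ((hΦ.monotone s hs t ht hst).smul (hc t ht)).add ((hΦ.posSemidef s hs).smul
      (mul_nonneg hε.1 (sub_nonneg.2 (hη hs ht hst))))
  · rw [hΦ.left_end, smul_zero]
  · rw [hηm, mul_zero, sub_zero, one_smul, hΦ.right_end]

/-- Path variation in the direction `-η Φ`: the integrand of the first variation is `x` times the
derivative of `⟨G + h hᵀ, -η Φ⟩`, so integrating by parts turns it into an integral against `μ`. -/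
theorem IsRegularPair.integral_sq_mul_pairing_gradient_nonneg (hp : IsRegularPair Q x Φ T)
    (hβ : IsMixture β) (hmin : IsMinimizer β h Q x μ Φ)
    {q : ℝ} (hq1 : q ≤ 1) (hq : q ≤ topPoint m x) :
    0 ≤ ∫ t in Icc 0 T, (max (q - t) 0) ^ 2 *
      pairing (gradient β x Φ t + Matrix.vecMulVec h h) (Φ t) ∂μ := by
  have hT := hp.cutoff_mem
  have hTI := Ioo_subset_Icc_self hT
  have hqT : q ≤ T := hq.trans hp.cutoff.1.le
  have hqm : q ≤ m := hqT.trans hT.2.le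
  -- The square makes `η` continuously differentiable at `q`, with `η` and `η'` both zero from there
  -- on; `q ≤ 1` gives `η ≤ 1` on `[0,m]`.
  set η : ℝ → ℝ := fun t => (max (q - t) 0) ^ 2 with hη
  set η' : ℝ → ℝ := fun t => -(2 * max (q - t) 0) with hη'
  have hηd : ∀ t, HasDerivAt η (η' t) t := fun t => by
    have := (hasDerivAt_sq_max (q - t)).comp t ((hasDerivAt_id t).const_sub q)
    exact this.congr_deriv (by simp [hη'])
  have hη'c : Continuous η' := by fun_prop
  have hηc : Continuous η := by fun_prop
  have hηq : ∀ t, q ≤ t → η t = 0 := fun t ht => by simp [hη, ht]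
  have hη'q : ∀ t, q ≤ t → η' t = 0 := fun t ht => by simp [hη', ht]
  have hηanti : Antitone η := fun s t hst => by
    simp only [hη]
    gcongr
  have hη1 : ∀ t ∈ Icc 0 (m : ℝ), η t ≤ 1 := fun t ht =>
    pow_le_one₀ (le_max_right _ _) (max_le (by linarith [ht.1]) zero_le_one)
  have hΦc := continuousOn_path hp.differentiable
  have hd : ∀ t ∈ Icc 0 (m : ℝ), HasEntryDerivWithinAt (fun t => -(η t • Φ t))
      (-(η' t • Φ t + η t • pathDeriv Φ t)) (Icc 0 (m : ℝ)) t := fun t ht i j =>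
    ((hηd t).hasDerivWithinAt.mul (hp.hasEntryDerivWithinAt_path ht i j)).neg
  have hdc : ContinuousOn (fun t => -(η' t • Φ t + η t • pathDeriv Φ t)) (Icc 0 (m : ℝ)) :=
    ((hη'c.continuousOn.smul hΦc).add (hηc.continuousOn.smul hp.continuousOn_deriv)).neg
  have hΨc : ContinuousOn (fun t => -(η t • Φ t)) (Icc 0 (m : ℝ)) :=
    (hηc.continuousOn.smul hΦc).neg
  have hvar := hp.integral_path_variation_nonneg hβ hmin hd hdc (by simp [hp.path.left_end]) hq
    (fun t ht => by simp [hηq t ht.1]) (fun t ht => by simp [hηq t ht.1, hη'q t ht.1])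
    (fun t ht i j => by
      have : Φ t j i = Φ t i j := by simpa using (hp.path.posSemidef t ht).1.apply i j
      simp [this])
    (fun ε hε => isMonotonePath_smul hp.path (hηanti.antitoneOn _) hη1
      (hηq m hqm) hε)
  have hgrad : ∀ t ∈ Icc 0 T, HasEntryDerivWithinAt
      (fun t => gradient β x Φ t + Matrix.vecMulVec h h) (gradientDeriv β x Φ t) (Icc 0 T) t :=
    fun t ht i j => (hp.hasEntryDerivWithinAt_gradient hβ ht i j).add_const _
  rw [integral_distribution_mul_deriv hp.orderParameter hmin.distribution hTI
    (p := fun t => pairing (gradient β x Φ t + Matrix.vecMulVec h h) (-(η t • Φ t)))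
    (fun t ht => (hgrad t ht).pairing ((hd t (hp.Icc_subset ht)).mono hp.Icc_subset))
    ((ContinuousOn.pairing (hp.continuousOn_gradientDeriv hβ) (hΨc.mono hp.Icc_subset)).add
      (hp.continuousOn_pairing_gradient hβ hdc))
    (by simp [hηq T hqT, pairing_zero_right])] at hvar
  rw [← integral_neg] at hvar
  simpa only [pairing_neg_right, pairing_smul_right, neg_neg] using hvar

/-! ### Expansions at the origin -/

lemma gradient_zero (hΦ : IsMonotonePath Q Φ) : gradient β x Φ 0 = 0 := by
  ext i j
  simp only [gradient, hΦ.left_end, sandwichIntegral_zero, Matrix.sub_apply, Matrix.zero_apply,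
    sub_zero]
  exact xiEntry_zero β i j

lemma HasEntryDerivWithinAt.tendsto_inv_smul {U : ℝ → Matrix (Fin m) (Fin m) ℝ}
    {U' : Matrix (Fin m) (Fin m) ℝ} {c : ℝ} (hc : 0 < c)
    (hU : HasEntryDerivWithinAt U U' (Icc 0 c) 0) (hU0 : U 0 = 0) :
    Tendsto (fun t : ℝ => t⁻¹ • U t) (𝓝[>] 0) (𝓝 U') := by
  refine tendsto_pi_nhds.2 fun i => tendsto_pi_nhds.2 fun j => ?_
  have h1 : HasDerivWithinAt (fun r => U r i j) (U' i j) (Ioi 0) 0 :=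
    (hU i j).mono_of_mem_nhdsWithin
      (mem_of_superset (Ioo_mem_nhdsGT hc) fun s hs => ⟨hs.1.le, hs.2.le⟩)
  have h2 := (hasDerivWithinAt_iff_tendsto_slope' (by simp)).1 h1
  refine h2.congr fun t => ?_
  simp [slope_def_field, hU0, div_eq_inv_mul]

lemma IsRegularPair.tendsto_inv_smul_gradient (hp : IsRegularPair Q x Φ T) (hβ : IsMixture β) :
    Tendsto (fun t : ℝ => t⁻¹ • gradient β x Φ t) (𝓝[>] 0) (𝓝 (gradientDeriv β x Φ 0)) :=
  (hp.hasEntryDerivWithinAt_gradient hβ ⟨le_rfl, hp.cutoff_mem.1.le⟩).tendsto_inv_smul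
    hp.cutoff_mem.1 (gradient_zero hp.path)

lemma tendsto_pairing {ι : Type*} {l : Filter ι} {A B : ι → Matrix (Fin m) (Fin m) ℝ}
    {A₀ B₀ : Matrix (Fin m) (Fin m) ℝ} (hA : Tendsto A l (𝓝 A₀)) (hB : Tendsto B l (𝓝 B₀)) :
    Tendsto (fun i => pairing (A i) (B i)) l (𝓝 (pairing A₀ B₀)) :=
  (continuous_id.matrix_trace.tendsto _).comp (hA.mul hB)

lemma IsRegularPair.tendsto_pairing_gradient_pathDeriv (hp : IsRegularPair Q x Φ T)
    (hβ : IsMixture β) :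
    Tendsto (fun t : ℝ => t⁻¹ * pairing (gradient β x Φ t) (pathDeriv Φ t)) (𝓝[>] 0)
      (𝓝 (pairing (gradientDeriv β x Φ 0) (pathDeriv Φ 0))) := by
  have hm : (0 : ℝ) < m := hp.cutoff_mem.1.trans hp.cutoff_mem.2
  have h2 : Tendsto (pathDeriv Φ) (𝓝[>] 0) (𝓝 (pathDeriv Φ 0)) :=
    (hp.continuousOn_deriv 0 ⟨le_rfl, hm.le⟩).mono_of_mem_nhdsWithin
      (mem_of_superset (Ioo_mem_nhdsGT hm) fun s hs => ⟨hs.1.le, hs.2.le⟩)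
  simpa only [pairing_smul_left] using tendsto_pairing (hp.tendsto_inv_smul_gradient hβ) h2

lemma IsRegularPair.tendsto_pairing_gradient_path (hp : IsRegularPair Q x Φ T)
    (hβ : IsMixture β) :
    Tendsto (fun t : ℝ => t⁻¹ * (t⁻¹ * pairing (gradient β x Φ t) (Φ t))) (𝓝[>] 0)
      (𝓝 (pairing (gradientDeriv β x Φ 0) (pathDeriv Φ 0))) := by
  have hm : (0 : ℝ) < m := hp.cutoff_mem.1.trans hp.cutoff_mem.2
  have h2 := (hp.hasEntryDerivWithinAt_path ⟨le_rfl, hm.le⟩).tendsto_inv_smul hm hp.path.left_end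
  simpa only [pairing_smul_left, pairing_smul_right] using
    tendsto_pairing (hp.tendsto_inv_smul_gradient hβ) h2

lemma pairing_vecMulVec_nonneg {M : Matrix (Fin m) (Fin m) ℝ} (hM : M.PosSemidef) (h : Fin m → ℝ) :
    0 ≤ pairing (Matrix.vecMulVec h h) M := by
  have e : pairing (Matrix.vecMulVec h h) M = star h ⬝ᵥ (M *ᵥ h) := by
    rw [quad_eq_sum, pairing_eq_sum, Finset.sum_comm]
    refine Finset.sum_congr rfl fun i _ => Finset.sum_congr rfl fun j _ => ?_
    rw [Matrix.vecMulVec_apply]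
    ring
  rw [e]
  exact hM.dotProduct_mulVec_nonneg h

/-- The field term is kept exact: a priori it is of first order in `q`, and only the inequality from
lowering `x` forces it down to second order. -/
lemma IsRegularPair.integral_pairing_gradient_eq (hp : IsRegularPair Q x Φ T) (hβ : IsMixture β)
    {q : ℝ} (hq0 : 0 ≤ q) (hqT : q ≤ T) :
    ∫ t in (0 : ℝ)..q, pairing (gradient β x Φ t + Matrix.vecMulVec h h) (pathDeriv Φ t)
      = (∫ t in (0 : ℝ)..q, pairing (gradient β x Φ t) (pathDeriv Φ t))
        + pairing (Matrix.vecMulVec h h) (Φ q) := by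
  have hT := hp.cutoff_mem
  have hsub : Icc 0 q ⊆ Icc 0 (m : ℝ) := Icc_subset_Icc_right (hqT.trans hT.2.le)
  have hc := hp.continuousOn_deriv.mono hsub
  have hi₁ : IntervalIntegrable (fun t => pairing (gradient β x Φ t) (pathDeriv Φ t)) volume 0 q :=
    (ContinuousOn.pairing ((hp.continuousOn_gradient hβ).mono (Icc_subset_Icc_right hqT))
      hc).intervalIntegrable_of_Icc hq0
  have hi₂ : IntervalIntegrable (fun t => pairing (Matrix.vecMulVec h h) (pathDeriv Φ t))
      volume 0 q := (ContinuousOn.pairing continuousOn_const hc).intervalIntegrable_of_Icc hq0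
  simp only [pairing_add_left]
  rw [intervalIntegral.integral_add hi₁ hi₂, intervalIntegral.integral_eq_sub_of_hasDerivAt_of_le
    hq0 (f := fun t => pairing (Matrix.vecMulVec h h) (Φ t))
    (ContinuousOn.pairing continuousOn_const ((continuousOn_path hp.differentiable).mono hsub)) _
    hi₂, hp.path.left_end, pairing_zero_right, sub_zero]
  intro t ht
  have hconst : HasEntryDerivWithinAt (fun _ => Matrix.vecMulVec h h) 0 univ t :=
    fun i j => hasDerivWithinAt_const _ _ _
  have hpath : HasEntryDerivWithinAt Φ (pathDeriv Φ t) univ t := fun i j =>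
    (hasDerivAt_path hp.differentiable ⟨ht.1, ht.2.trans_le (hqT.trans hT.2.le)⟩ i
      j).hasDerivWithinAt
  simpa [pairing_zero_left] using hasDerivWithinAt_univ.1 (hconst.pairing hpath)

lemma mul_sq_le_integral {a : ℝ → ℝ} {c q : ℝ} (hq0 : 0 ≤ q)
    (ha : IntervalIntegrable a volume 0 q) (h : ∀ t ∈ Ioo 0 q, c * t ≤ a t) :
    c * q ^ 2 / 2 ≤ ∫ t in (0 : ℝ)..q, a t := by
  have e : ∫ t in (0 : ℝ)..q, c * t = c * q ^ 2 / 2 := by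
    rw [intervalIntegral.integral_const_mul, integral_id]
    ring
  rw [← e]
  exact intervalIntegral.integral_mono_on_of_le_Ioo hq0
    (Continuous.intervalIntegrable (by fun_prop) _ _) ha h

/-- At a minimizer whose distribution charges every right neighbourhood of the origin, the second
order term of the gradient along the path vanishes. -/
theorem IsRegularPair.pairing_gradientDeriv_eq_zero (hp : IsRegularPair Q x Φ T)
    (hβ : IsMixture β) (hmin : IsMinimizer β h Q x μ Φ)
    (hx0 : ∀ t ∈ Ioc 0 (m : ℝ), x 0 < x t) :
    pairing (gradientDeriv β x Φ 0) (pathDeriv Φ 0) = 0 := by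
  have hx := hp.orderParameter
  have hT := hp.cutoff_mem
  have hm : (0 : ℝ) < m := hT.1.trans hT.2
  -- Otherwise `x 0 = 1 = x m`, against `hx0`.
  have htop0 : 0 < topPoint m x := by
    refine (topPoint_mem hx).1.lt_of_ne fun heq => ?_
    have h1 := apply_topPoint hx
    rw [← heq] at h1
    have h2 := hx0 m ⟨hm, le_rfl⟩
    rw [h1, hx.right_end] at h2
    exact lt_irrefl _ h2
  have hpos : ∀ t ∈ Ioc 0 (m : ℝ), 0 < x t := fun t ht =>
    (hx.nonneg 0 ⟨le_rfl, hm.le⟩).trans_lt (hx0 t ht)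
  set γ := pairing (gradientDeriv β x Φ 0) (pathDeriv Φ 0) with hγ
  have hint : ∀ {q : ℝ}, 0 ≤ q → q ≤ T →
      IntervalIntegrable (fun t => pairing (gradient β x Φ t) (pathDeriv Φ t)) volume 0 q :=
    fun hq0 hqT => (ContinuousOn.pairing ((hp.continuousOn_gradient hβ).mono
      (Icc_subset_Icc_right hqT)) (hp.continuousOn_deriv.mono
        (Icc_subset_Icc_right (hqT.trans hT.2.le)))).intervalIntegrable_of_Icc hq0
  have hupper : ∀ {q c : ℝ}, 0 < q → q ≤ topPoint m x →
      (∀ t ∈ Ioo 0 q, c * t ≤ pairing (gradient β x Φ t) (pathDeriv Φ t)) →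
      c * q ^ 2 / 2 + pairing (Matrix.vecMulVec h h) (Φ q) ≤ 0 := fun hq0 hq hc => by
    have hqT := hq.trans hp.cutoff.1.le
    have h1 := hp.integral_pairing_gradient_nonpos hβ hmin hpos hq0 hq
    rw [hp.integral_pairing_gradient_eq hβ hq0.le hqT] at h1
    have h2 := mul_sq_le_integral hq0.le (hint hq0.le hqT) hc
    linarith
  by_contra hne
  have hsmall : ∀ {c : ℝ}, c < γ → ∀ᶠ q in 𝓝[>] (0 : ℝ), ∀ t ∈ Ioo 0 q,
      c * t ≤ pairing (gradient β x Φ t) (pathDeriv Φ t) := fun {c} hc => by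
    have hev := (hp.tendsto_pairing_gradient_pathDeriv hβ).eventually (lt_mem_nhds hc)
    obtain ⟨ρ, hρ, hρ'⟩ := mem_nhdsGT_iff_exists_Ioo_subset.1 hev
    filter_upwards [Ioo_mem_nhdsGT hρ] with q hq t ht
    have h1 : c < t⁻¹ * pairing (gradient β x Φ t) (pathDeriv Φ t) := hρ' ⟨ht.1, ht.2.trans hq.2⟩
    rw [inv_mul_eq_div, lt_div_iff₀ ht.1] at h1
    exact h1.le
  have hfnn : ∀ {q : ℝ}, q ∈ Icc 0 (m : ℝ) → 0 ≤ pairing (Matrix.vecMulVec h h) (Φ q) :=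
    fun hq => pairing_vecMulVec_nonneg (hp.path.posSemidef _ hq) h
  rcases lt_or_gt_of_ne hne with hneg | hgt
  -- Slack constants: with slope `5γ/4` the first inequality bounds the field term by `-5γt²/8`,
  -- while `⟨G, Φ⟩ < 3γt²/4`. The sum is below `γt²/8 < 0`.
  · have hc : (5 / 4) * γ < γ := by linarith
    have hev₂ := (hp.tendsto_pairing_gradient_path hβ).eventually
      (gt_mem_nhds (show γ < (3 / 4) * γ by linarith))
    have hneg' : ∀ᶠ t in 𝓝[>] (0 : ℝ),
        pairing (gradient β x Φ t + Matrix.vecMulVec h h) (Φ t) < 0 := by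
      filter_upwards [hsmall hc, hev₂, Ioo_mem_nhdsGT htop0] with t h1 h2 ht
      have h3 := hupper ht.1 ht.2.le h1
      rw [← mul_assoc, ← sq, inv_pow, inv_mul_eq_div, div_lt_iff₀ (by have := ht.1; positivity)]
        at h2
      rw [pairing_add_left]
      have h4 : γ * t ^ 2 < 0 := mul_neg_of_neg_of_pos hneg (by have := ht.1; positivity)
      linarith
    obtain ⟨ρ, hρ, hρ'⟩ := mem_nhdsGT_iff_exists_Ioo_subset.1 hneg'
    have hρ0 : 0 < ρ := hρ
    set q := min (min ρ 1) (topPoint m x)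
    have hq0 : 0 < q := lt_min (lt_min hρ0 one_pos) htop0
    have hqtop : q ≤ topPoint m x := min_le_right _ _
    have hqT : q ≤ T := hqtop.trans hp.cutoff.1.le
    have hqρ : q ≤ ρ := (min_le_left _ _).trans (min_le_left _ _)
    have hvar := hp.integral_sq_mul_pairing_gradient_nonneg hβ hmin
      ((min_le_left _ _).trans (min_le_right _ _)) hqtop
    set p : ℝ → ℝ := fun t => (max (q - t) 0) ^ 2 *
      pairing (gradient β x Φ t + Matrix.vecMulVec h h) (Φ t) with hpdef
    have hple : ∀ t ∈ Icc 0 T, p t ≤ 0 := fun t ht => by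
      rcases ht.1.eq_or_lt with rfl | ht0
      · simp [hpdef, hp.path.left_end, pairing_zero_right]
      · rcases lt_or_ge t q with htq | htq
        · exact mul_nonpos_of_nonneg_of_nonpos (sq_nonneg _)
            (le_of_lt (hρ' ⟨ht0, htq.trans_le hqρ⟩))
        · simp [hpdef, htq]
    have hpc : ContinuousOn p (Icc 0 T) :=
      ContinuousOn.mul (by fun_prop) (hp.continuousOn_pairing_gradient hβ
        (continuousOn_path hp.differentiable))
    have hTI := Ioo_subset_Icc_self hT
    have hfin : μ (Icc 0 T) ≠ ⊤ := by
      rw [hmin.distribution.measure_Icc T hTI]; exact ENNReal.ofReal_ne_top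
    have hpi : IntegrableOn (fun t => -p t) (Icc 0 T) μ := by
      obtain ⟨C, hC⟩ := isCompact_Icc.exists_bound_of_continuousOn hpc.neg
      have : IsFiniteMeasure (μ.restrict (Icc 0 T)) := ⟨by simpa using hfin.lt_top⟩
      exact Integrable.of_bound (hpc.neg.aestronglyMeasurable measurableSet_Icc) C
        ((ae_restrict_iff' measurableSet_Icc).2 (Eventually.of_forall hC))
    have hposI : 0 < ∫ t in Icc 0 T, -p t ∂μ := by
      rw [setIntegral_pos_iff_support_of_nonneg_ae
        ((ae_restrict_iff' measurableSet_Icc).2 (Eventually.of_forall fun t ht =>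
          neg_nonneg.2 (hple t ht))) hpi]
      have hq2 : q / 2 ∈ Icc 0 (m : ℝ) := ⟨by linarith, by linarith [hT.2.le]⟩
      -- The integrand is strictly negative on `(0, q/2]`, whose `μ`-mass is at least `x (q/2) - x 0
      -- > 0`.
      have hsub : Icc 0 (q / 2) \ Icc 0 0 ⊆ (Function.support fun t => -p t) ∩ Icc 0 T := by
        intro t ht
        have ht0 : 0 < t := ht.1.1.lt_of_ne fun h => ht.2 (by simp [← h])
        have htq : t < q := by linarith [ht.1.2]
        refine ⟨?_, ⟨ht0.le, htq.le.trans hqT⟩⟩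
        have h1 : pairing (gradient β x Φ t + Matrix.vecMulVec h h) (Φ t) < 0 :=
          hρ' ⟨ht0, htq.trans_le hqρ⟩
        have h2 : 0 < max (q - t) 0 := lt_max_of_lt_left (by linarith)
        simp only [Function.mem_support, hpdef, ne_eq, neg_eq_zero, mul_eq_zero, not_or]
        exact ⟨by positivity, h1.ne⟩
      refine lt_of_lt_of_le ?_ (measure_mono hsub)
      refine lt_of_lt_of_le ?_ le_measure_sdiff
      rw [hmin.distribution.measure_Icc _ hq2,
        hmin.distribution.measure_Icc 0 ⟨le_rfl, hm.le⟩, tsub_pos_iff_lt]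
      exact (ENNReal.ofReal_lt_ofReal_iff (hpos _ ⟨by linarith, hq2.2⟩)).2
        (hx0 _ ⟨by linarith, hq2.2⟩)
    rw [integral_neg] at hposI
    linarith
  · have hgt' : 0 < γ := hgt
    have hc : γ / 2 < γ := by linarith
    -- For `γ > 0` the first inequality fails on its own: its second-order term is positive and the
    -- field term nonnegative.
    obtain ⟨q, h1, hq⟩ := ((hsmall hc).and (Ioo_mem_nhdsGT htop0)).exists
    have h2 := hupper hq.1 hq.2.le h1
    have h3 := hfnn (q := q) ⟨hq.1.le, hq.2.le.trans (topPoint_mem hx).2⟩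
    have h4 : 0 < γ / 2 * q ^ 2 / 2 := by have := hq.1; positivity
    linarith

/-- As `Φ 0 = 0`, only the linear coefficient of `ξ'` survives, which is the `p = 2` term. -/
lemma IsRegularPair.pairing_gradientDeriv_zero_eq (hp : IsRegularPair Q x Φ T)
    (hβ : IsMixture β) :
    pairing (gradientDeriv β x Φ 0) (pathDeriv Φ 0)
      = 2 * pairing (Matrix.vecMulVec (β 2) (β 2)) (pathDeriv Φ 0 ⊙ pathDeriv Φ 0)
        - pairing ((hatPath x Φ 0)⁻¹ * pathDeriv Φ 0) ((hatPath x Φ 0)⁻¹ * pathDeriv Φ 0) := by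
  have h0 : (0 : ℝ) ∈ Icc 0 (m : ℝ) := ⟨le_rfl, by positivity⟩
  rw [gradientDeriv, pairing_sub_left]
  congr 1
  · simp only [pairing_eq_sum, Finset.mul_sum, Matrix.hadamard_apply]
    refine Finset.sum_congr rfl fun i _ => Finset.sum_congr rfl fun j _ => ?_
    have : pathDeriv Φ 0 j i = pathDeriv Φ 0 i j := by
      simpa using (posSemidef_pathDeriv hp.one_le hp.path hp.differentiable h0).1.apply i j
    rw [this, xiDeriv2, Matrix.of_apply, hp.path.left_end, Matrix.zero_apply,
      deriv_xiEntry_zero hβ, Matrix.vecMulVec_apply]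
    ring
  · simp only [pairing, sandwich, Matrix.mul_assoc]

end Origin

end VectorSpin

end

theorem mainTheorem12 {m : ℕ} (hm : 1 ≤ m)
    (β : ℕ → Fin m → ℝ) (hβ : VectorSpin.IsMixture β) (h : Fin m → ℝ)
    (Q : Matrix (Fin m) (Fin m) ℝ) (hQ : VectorSpin.IsConstraint Q)
    (x : ℝ → ℝ) (μP : Measure ℝ) (Φ : ℝ → Matrix (Fin m) (Fin m) ℝ)
    (hmin : VectorSpin.IsMinimizer β h Q x μP Φ)
    (h0 : (0 : ℝ) ∈ μP.support)
    (hne : 2 * VectorSpin.pairing (Matrix.vecMulVec (β 2) (β 2))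
          (VectorSpin.pathDeriv Φ 0 ⊙ VectorSpin.pathDeriv Φ 0)
        ≠ VectorSpin.pairing ((VectorSpin.hatPath x Φ 0)⁻¹ * VectorSpin.pathDeriv Φ 0)
          ((VectorSpin.hatPath x Φ 0)⁻¹ * VectorSpin.pathDeriv Φ 0)) :
    ∃ q : ℝ, 0 < q ∧ q ≤ m ∧ μP (Icc 0 q) = μP {0} ∧ μP.support ∩ Ico 0 q = {0} := by
  have hm0 : (0 : ℝ) ≤ m := by positivity
  have h0I : (0 : ℝ) ∈ Icc 0 (m : ℝ) := ⟨le_rfl, hm0⟩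
  have hx := hmin.orderParameter
  -- It suffices that `x` fails to increase strictly away from `0`: then it is constant on some
  -- `[0,q]`, so `(0,q]` carries no mass.
  obtain ⟨q, hq, hxq⟩ : ∃ q ∈ Ioc 0 (m : ℝ), x q ≤ x 0 := by
    by_contra hcon
    push Not at hcon
    obtain ⟨T, hp⟩ := hmin.exists_isRegularPair hm hQ
    have hzero := hp.pairing_gradientDeriv_eq_zero hβ hmin hcon
    rw [hp.pairing_gradientDeriv_zero_eq hβ, sub_eq_zero] at hzero
    exact hne hzero
  have hqI : q ∈ Icc 0 (m : ℝ) := ⟨hq.1.le, hq.2⟩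
  have hxeq : x q = x 0 := le_antisymm hxq (hx.monotoneOn h0I hqI hq.1.le)
  have hμ : μP (Icc 0 q) = μP {0} := by
    rw [hmin.distribution.measure_Icc q hqI, hxeq, ← hmin.distribution.measure_Icc 0 h0I,
      Icc_self]
  refine ⟨q, hq.1, hq.2, hμ, Subset.antisymm (fun t ht => ?_) ?_⟩
  · by_contra ht0
    have htpos : 0 < t := ht.2.1.lt_of_ne fun e => ht0 (by simp [← e])
    have hpos := (Measure.mem_support_iff_forall t).1 ht.1 _ (Ioo_mem_nhds htpos ht.2.2)
    have hfin : μP {0} ≠ ⊤ := by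
      rw [← hμ, hmin.distribution.measure_Icc q hqI]; exact ENNReal.ofReal_ne_top
    -- A support point in `(0,q)` would give positive mass to the open interval `(0,q)`, which lies
    -- in this null set.
    have hdiff : μP (Icc 0 q \ {0}) = 0 := by
      rw [measure_sdiff (by simpa using hq.1.le) (measurableSet_singleton 0).nullMeasurableSet hfin,
        hμ, tsub_self]
    refine absurd hpos (not_lt.2 (le_of_eq (measure_mono_null (fun s hs => ?_) hdiff)))
    exact ⟨⟨hs.1.le, hs.2.le⟩, hs.1.ne'⟩
  · rintro t rfl
    exact ⟨h0, le_rfl, hq.1⟩
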